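/- Let $0<\alpha<2$, let $m_1,m_2,m_3>0$ with $m_1=m_2$, and let $\mathbf k=\{1,2\}$ or $\mathbf k=\{1,2,3\}$. For $x=(x_i)_{i\in\mathbf k}\in(\mathbb R^2)^{\mathbf k}$ put $U(x)=\sum_{i<j,\ i,j\in\mathbf k} m_im_j|x_i-x_j|^{-\alpha}$ ($+\infty$ if two of the $x_i$ coincide), and for a path $x(t)$ put $\mathcal L_{\mathbf k}(x)=\frac12\sum_{i\in\mathbf k} m_i|\dot x_i|^2+U(x)$. A central configuration is a $\xi\in(\mathbb R^2)^{\mathbf k}$ with $\sum_i m_i\xi_i=0$ and pairwise distinct $\xi_i$ that is a critical point of $U$ restricted to the ellipsoid $\{x:\sum_i m_ix_i=0,\ \sum_i m_i|x_i|^2=\sum_i m_i|\xi_i|^2\}$. A parabolic collision trajectory for $\mathbf k$ is a path $q:\mathbb R\to(\mathbb R^2)^{\mathbf k}$ of the form $q(t)=|t|^{2/(2+\alpha)}\xi^+$ for $t\ge 0$ and $q(t)=|t|^{2/(2+\alpha)}\xi^-$ for $t\le 0$, with central configurations $\xi^+,\xi^-$ (in particular $\xi^+=\xi^-$ is allowed).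 Fix a line $l\subset\mathbb R^2$ through $0$ and let $\rho$ be the reflection of $\mathbb R^2$ in $l$. Let $g_0$ act on $(\mathbb R^2)^{\mathbf k}$ by $(g_0x)_i=\rho\,x_{\sigma(i)}$, where $\sigma=(1\,2)$. A path $y$ is called $g_0$-equivariant if $y(-t)=g_0\,y(t)$ for all $t\in\mathbb R$. For $\delta\in(\mathbb R^2)^{\mathbf k}$ with norm $|\delta|=(\sum_i|\delta_i|^2)^{1/2}$ and $T>0$ with $0<|\delta|<T$, the standard variation $v^\delta$ associated to $\delta$ and $T$ is $v^\delta(t)=\delta$ for $|t|\le T-|\delta|$, $v^\delta(t)=(T-|t|)\,\delta/|\delta|$ for $T-|\delta|\le|t|\le T$, and $v^\delta(t)=0$ for $|t|\ge T$. **Theorem.** Let $q$ be a $g_0$-equivariant parabolic collision trajectory for $\mathbf k$. Then for every $T>0$ and every $\varepsilon>0$ there is a $\delta\in(\mathbb R^2)^{\mathbf k}$ with $0<|\delta|<\min(\varepsilon,T)$ such that $v^\delta$ is $g_0$-equivariant, the points $(q+v^\delta)_i(0)$, $i\in\mathbf k$, are pairwise distinct (no collision at $t=0$), the function $\mathcal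 L_{\mathbf k}(q+v^\delta)-\mathcal L_{\mathbf k}(q)$ is finite almost everywhere and integrable on $\mathbb R$, and $$\int_{-\infty}^{+\infty}\big[\mathcal L_{\mathbf k}(q+v^\delta)-\mathcal L_{\mathbf k}(q)\big]\,dt<0 .$$ Consequently $q$ is not minimizing among $g_0$-equivariant escaping paths: it is not true that $\int_{-\infty}^{+\infty}[\mathcal L_{\mathbf k}(q+\varphi)-\mathcal L_{\mathbf k}(q)]\,dt\ge 0$ for all $\varphi\in H^1_0(\mathbb R;(\mathbb R^2)^{\mathbf k})$ such that $q+\varphi$ is $g_0$-equivariant and this integrand is finite almost everywhere and integrable. -/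

import Mathlib

open MeasureTheory

noncomputable section

/-- The Euclidean plane `E = ℝ²`. -/
abbrev Plane : Type := EuclideanSpace ℝ (Fin 2)

namespace NBody

variable {ι : Type*} [Fintype ι]

/-- Configurations with a collision: two different bodies at the same place. -/
def HasCollision (x : ι → Plane) : Prop := ∃ i j, i ≠ j ∧ x i = x j

/-- The `α`-homogeneous potential `U(x) = ∑_{i < j} m_i m_j / |x_i - x_j| ^ α`. At a collision, where
the potential is `+∞`, the real number computed here has no meaning; whenever an action is
considered below, collisions are required to happen only on a null set of times. -/
def potential [LinearOrder ι] (α : ℝ) (m : ι → ℝ) (x : ι → Plane) : ℝ :=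
  ∑ i, ∑ j with i < j, m i * m j / ‖x i - x j‖ ^ α

/-- The kinetic energy `K = (1/2) ∑ m_i |v_i|²`. -/
def kinetic (m : ι → ℝ) (v : ι → Plane) : ℝ := (1 / 2) * ∑ i, m i * ‖v i‖ ^ 2

/-- The Lagrangian `L = K + U` of the bodies in `ι`. -/
def lagrangian [LinearOrder ι] (α : ℝ) (m : ι → ℝ) (x v : ι → Plane) : ℝ :=
  kinetic m v + potential α m x

/-- `ξ` is a central configuration: a collisionless configuration with centre of mass `0` that is a
critical point of `U` restricted to the ellipsoid `∑ m_i |x_i|² = c` (in the space of configurations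
with centre of mass `0`) on which it lies, i.e. the differential of `U` at `ξ` vanishes on the
vectors tangent to that ellipsoid. The size `c = ∑ m_i |ξ_i|²` is arbitrary. -/
def IsCentralConfiguration [LinearOrder ι] (α : ℝ) (m : ι → ℝ) (ξ : ι → Plane) : Prop :=
  ¬ HasCollision ξ ∧ ∑ i, m i • ξ i = 0 ∧
    ∀ v : ι → Plane, ∑ i, m i • v i = 0 → ∑ i, m i * inner ℝ (ξ i) (v i) = 0 →
      fderiv ℝ (potential α m) ξ v = 0

/-- `q` is a parabolic collision trajectory: `q_i(t) = |t| ^ (2 / (2 + α)) ξ_i`, with `ξ` a central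
configuration. The ejection branch `t ≥ 0` and the collision branch `t ≤ 0` are allowed to have
different central configurations `ξ⁺` and `ξ⁻`; the case `ξ⁺ = ξ⁻` is included. -/
def IsParabolicCollisionTrajectory [LinearOrder ι] (α : ℝ) (m : ι → ℝ) (q : ℝ → ι → Plane) :
    Prop :=
  ∃ ξp ξn : ι → Plane, IsCentralConfiguration α m ξp ∧ IsCentralConfiguration α m ξn ∧
    (∀ t : ℝ, 0 ≤ t → ∀ i, q t i = |t| ^ (2 / (2 + α)) • ξp i) ∧
    (∀ t : ℝ, t ≤ 0 → ∀ i, q t i = |t| ^ (2 / (2 + α)) • ξn i)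

/-- The action on configurations of the element that acts on the plane as the reflection in the
line `l` and on the indices as the permutation `σ`: `(g x)_i = ρ(g) x_{σ⁻¹ i}`. -/
def act (l : Submodule ℝ Plane) (σ : Equiv.Perm ι) (x : ι → Plane) : ι → Plane :=
  fun i => l.reflection (x (σ.symm i))

/-- Equivariance of a path under the element that moreover reverses time: `y (-t) = g (y t)`. -/
def IsEquivariant (l : Submodule ℝ Plane) (σ : Equiv.Perm ι) (y : ℝ → ι → Plane) : Prop :=
  ∀ t, y (-t) = act l σ (y t)

/-- The Euclidean norm `|δ| = (∑ |δ_i|²) ^ (1/2)` of a vector of `(ℝ²)^ι`. -/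
def euclNorm (δ : ι → Plane) : ℝ := Real.sqrt (∑ i, ‖δ i‖ ^ 2)

/-- The standard variation associated to `δ ≠ 0` and `T`. -/
def standardVariation (δ : ι → Plane) (T : ℝ) (t : ℝ) : ι → Plane :=
  if |t| ≤ T - euclNorm δ then δ
  else if |t| ≤ T then ((T - |t|) / euclNorm δ) • δ
  else 0

/-- The Sobolev space `H¹₀(ℝ) = H¹(ℝ)` of paths `ℝ → (ℝ²)^ι` (continuous representatives): `φ` is
square integrable and is a primitive of a square integrable function, its weak derivative. -/
def MemH1 (φ : ℝ → ι → Plane) : Prop :=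
  MemLp φ 2 volume ∧
    ∃ ψ : ℝ → ι → Plane, MemLp ψ 2 volume ∧ ∀ t, φ t = φ 0 + ∫ s in (0 : ℝ)..t, ψ s

/-- The integrand `L(q + φ) - L(q)` of the variation of the action. -/
def lagrangianVariation [LinearOrder ι] (α : ℝ) (m : ι → ℝ) (q φ : ℝ → ι → Plane) (t : ℝ) : ℝ :=
  lagrangian α m ((q + φ) t) (deriv (q + φ) t) - lagrangian α m (q t) (deriv q t)

/-- The variation of the action `∫ (L(q + φ) - L(q)) dt` over the real line is well defined and
finite: `q + φ` is collisionless at almost every time (so that its potential is a.e. finite) and the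
integrand is integrable. -/
def FiniteActionVariation [LinearOrder ι] (α : ℝ) (m : ι → ℝ) (q φ : ℝ → ι → Plane) : Prop :=
  (∀ᵐ t : ℝ, ¬ HasCollision ((q + φ) t)) ∧ Integrable (lagrangianVariation α m q φ)

/-- The variation of the action `Δ𝒜 = ∫ (L(q + φ) - L(q)) dt`. -/
def actionVariation [LinearOrder ι] (α : ℝ) (m : ι → ℝ) (q φ : ℝ → ι → Plane) : ℝ :=
  ∫ t : ℝ, lagrangianVariation α m q φ t

/-- `q` is minimizing among equivariant escaping paths `q + φ`, `φ ∈ H¹₀(ℝ)`: the variation of the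
action is nonnegative. (Paths for which the variation of the action is `+∞` impose no condition.) -/
def IsEquivariantMinimizing [LinearOrder ι] (α : ℝ) (m : ι → ℝ) (l : Submodule ℝ Plane)
    (σ : Equiv.Perm ι) (q : ℝ → ι → Plane) : Prop :=
  ∀ φ : ℝ → ι → Plane, MemH1 φ → IsEquivariant l σ (q + φ) → FiniteActionVariation α m q φ →
    0 ≤ actionVariation α m q φ

end NBody

end

/-!
Why a parabolic collision trajectory `q` that is equivariant under a time-reversing reflection
exchanging the two equal masses does not minimize the action.

Displacing `q` near the collision by `δ = s e`, with `e` fixed and `s` small, changes the kinetic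
part of the action by `O(s)` only, since the displacement is constant except on two time intervals
of length `O(s)` away from the collision. As `q` moves like `t ^ β ξ` with `β = 2 / (2 + α)`, the
displacement matters for the potential during a time of order `s ^ (1 / β) = s ^ (1 + α / 2)`, when
it changes the potential by an amount of order `s ^ (-α)`. So the change of the potential part is of
order `s ^ (1 - α / 2)`, which dominates `s`, and it suffices that its coefficient be negative. Such
an `e` is called a `DescentDirection`, and `eventually_actionVariation_neg` carries out this
argument, with pointwise bounds for the potential in place of an asymptotic expansion.

A pair contributes negatively if its relative displacement does not point backwards, that is, makes
an angle of at most `π / 2` with the relative position, and still does so if the angle is slightly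
larger (`exists_pairBound`). The displacements fixed by the symmetry are, in coordinates along the
line `l` and across it, `e₀ = (d, b)`, `e₁ = (d, -b)`, `e₂ = (c, 0)`; one may take `c = 0`. The
relative displacements are then `(0, 2 b)`, `(d, b)`, `(d, -b)`, and the symmetry of `q` makes the
conditions for its two branches the same up to exchanging the first two bodies.

* For two bodies the sign of `b` can be chosen such that the displacement does not point backwards.
* If along `l` the first two bodies lie weakly on the same side of the third, take `d = ±1` with the
  right sign and `b` small with the right sign (`eventually_descentDirection`).
* If the third body lies strictly between the other two along `l`, then, because the first two
  masses are equal, the equations of a central configuration force its distances to the other two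
  to agree (`IsCentralConfiguration.norm_sub_eq`; these are the equilateral and the symmetric
  collinear configurations). For such an isosceles triangle there are `d` and `b ≠ 0` for which no
  relative displacement points backwards (`exists_symmetric_of_isosceles`).
-/

namespace NBody

/-! ### The attraction of one pair under a displacement -/

section PairEstimates

variable {V : Type*} [NormedAddCommGroup V]

lemma div_norm_rpow_eq (α : ℝ) (x : V) (c : ℝ) : c / ‖x‖ ^ α = c * (‖x‖ ^ 2) ^ (-(α / 2)) := by
  rw [← Real.rpow_natCast ‖x‖ 2, ← Real.rpow_mul (norm_nonneg x), div_eq_mul_inv,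
    ← Real.rpow_neg (norm_nonneg x)]
  congr 2
  push_cast
  ring

variable [InnerProductSpace ℝ V]

lemma norm_smul_add_smul_sq (ξ e : V) (u s : ℝ) :
    ‖u • ξ + s • e‖ ^ 2 = u ^ 2 * ‖ξ‖ ^ 2 + 2 * (u * s) * inner ℝ ξ e + s ^ 2 * ‖e‖ ^ 2 := by
  rw [norm_add_sq_real, norm_smul, norm_smul, inner_smul_left, inner_smul_right, mul_pow, mul_pow,
    Real.norm_eq_abs, Real.norm_eq_abs, sq_abs, sq_abs]
  simp only [conj_trivial]
  ring

lemma rpow_neg_half_sq_mul {α u A : ℝ} (hu : 0 < u) (hA : 0 ≤ A) :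
    (u ^ 2 * A) ^ (-(α / 2)) = u ^ (-α) * A ^ (-(α / 2)) := by
  rw [Real.mul_rpow (sq_nonneg u) hA, ← Real.rpow_natCast u 2, ← Real.rpow_mul hu.le]
  congr 2
  push_cast
  ring

/-- Local Lipschitz bound for `y ↦ y ^ p` to the left of `A`. -/
lemma exists_rpow_sub_le (p : ℝ) {A : ℝ} (hA : 0 < A) :
    ∃ C : ℝ, 0 ≤ C ∧ ∀ x, 0 ≤ x → x ≤ A / 2 → (A - x) ^ p - A ^ p ≤ C * x := by
  have hc : ContDiffOn ℝ 1 (fun y : ℝ => y ^ p) (Set.Icc (A / 2) A) := fun y hy =>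
    (Real.contDiffAt_rpow_const (Or.inl (by have := hy.1; linarith : y ≠ 0))).contDiffWithinAt
  obtain ⟨K, hK⟩ := hc.exists_lipschitzOnWith one_ne_zero (convex_Icc _ _) isCompact_Icc
  refine ⟨K, K.2, fun x hx hx' => ?_⟩
  have := hK.dist_le_mul (A - x) ⟨by linarith, by linarith⟩ A ⟨by linarith, le_refl _⟩
  rw [Real.dist_eq, Real.dist_eq] at this
  have h2 : |A - x - A| = x := by rw [show A - x - A = -x by ring, abs_neg, abs_of_nonneg hx]
  rw [h2] at this
  exact (le_abs_self _).trans this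

/-- For the relative position `ξ` of one pair and its displacement `e`: `u ξ + s e` is never a
collision, the attraction falls by at least `c s ^ (-α)` as long as `u ≤ s`, and for `s ≤ u` it
rises by at most `κ s u ^ (-(α + 1))`. -/
structure PairBound (α : ℝ) (ξ e : V) (c κ : ℝ) : Prop where
  ne_zero : ∀ u s : ℝ, 0 ≤ u → 0 ≤ s → 0 < u + s → u • ξ + s • e ≠ 0
  near : ∀ u s : ℝ, 0 < u → 0 < s → u ≤ s →
    1 / ‖u • ξ + s • e‖ ^ α - 1 / ‖u • ξ‖ ^ α ≤ -c * s ^ (-α)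
  far : ∀ u s : ℝ, 0 < u → 0 < s → s ≤ u →
    1 / ‖u • ξ + s • e‖ ^ α - 1 / ‖u • ξ‖ ^ α ≤ κ * (s * u ^ (-(α + 1)))

/-- If `e` points backwards by at most `η`, then the possible rise of the attraction is of order
`η`. The constants depend on `e` only through a lower bound for its length, which is what makes
slightly obtuse angles admissible. -/
lemma exists_pairBound {α : ℝ} (hα : 0 < α) {ξ : V} (hξ : ξ ≠ 0) {ε : ℝ} (hε : 0 < ε) :
    ∃ c C η₀ : ℝ, 0 < c ∧ 0 ≤ C ∧ 0 < η₀ ∧ ∀ (e : V) (η : ℝ), ε ≤ ‖e‖ ^ 2 → 0 ≤ η → η ≤ η₀ →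
      -η ≤ inner ℝ ξ e → PairBound α ξ e c (C * η) := by
  have hA : 0 < ‖ξ‖ ^ 2 := by positivity
  set A := ‖ξ‖ ^ 2 with hAdef
  have hα2 : -(α / 2) ≤ 0 := by linarith
  obtain ⟨C, hC, hCx⟩ := exists_rpow_sub_le (-(α / 2)) hA
  refine ⟨A ^ (-(α / 2)) - (A + ε / 2) ^ (-(α / 2)), 2 * C, min (ε / 4) (A / 4), ?_, by positivity,
    by positivity, ?_⟩
  · exact sub_pos.2 (Real.rpow_lt_rpow_of_neg hA (by linarith) (by linarith))
  intro e η he hη hη₀ hin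
  have hη1 : η ≤ ε / 4 := hη₀.trans (min_le_left _ _)
  have hη2 : η ≤ A / 4 := hη₀.trans (min_le_right _ _)
  have key : ∀ u s : ℝ, 0 ≤ u → 0 ≤ s →
      u ^ 2 * A - 2 * (u * s) * η + s ^ 2 * ε ≤ ‖u • ξ + s • e‖ ^ 2 := by
    intro u s hu hs
    rw [norm_smul_add_smul_sq]
    nlinarith [mul_le_mul_of_nonneg_left hin (mul_nonneg hu hs),
      mul_le_mul_of_nonneg_left he (sq_nonneg s)]
  have near : ∀ u s : ℝ, 0 ≤ u → 0 ≤ s → u ≤ s →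
      u ^ 2 * A + s ^ 2 * (ε / 2) ≤ ‖u • ξ + s • e‖ ^ 2 := by
    intro u s hu hs hus
    refine le_trans ?_ (key u s hu hs)
    have h1 : u * s * η ≤ s ^ 2 * (ε / 4) :=
      mul_le_mul (by nlinarith) hη1 hη (sq_nonneg s)
    linarith
  have far : ∀ u s : ℝ, 0 ≤ u → 0 ≤ s → s ≤ u →
      u ^ 2 * (A / 2) + s ^ 2 * ε ≤ ‖u • ξ + s • e‖ ^ 2 := by
    intro u s hu hs hus
    refine le_trans ?_ (key u s hu hs)
    have h1 : u * s * η ≤ u ^ 2 * (A / 4) :=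
      mul_le_mul (by nlinarith) hη2 hη (sq_nonneg u)
    linarith
  refine ⟨fun u s hu hs hus h0 => ?_, fun u s hu hs hus => ?_, fun u s hu hs hsu => ?_⟩
  · have hn : ‖u • ξ + s • e‖ ^ 2 = 0 := by rw [h0]; simp
    rcases le_total u s with h | h
    · have h1 := near u s hu hs h
      have : 0 < s := by linarith
      have : 0 < u ^ 2 * A + s ^ 2 * (ε / 2) := by positivity
      linarith
    · have h1 := far u s hu hs h
      have : 0 < u := by linarith
      have : 0 < u ^ 2 * (A / 2) + s ^ 2 * ε := by positivity
      linarith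
  · rw [div_norm_rpow_eq, div_norm_rpow_eq, one_mul, one_mul, norm_smul, mul_pow,
      Real.norm_eq_abs, sq_abs, ← hAdef, rpow_neg_half_sq_mul hu hA.le]
    have h1 : u ^ 2 * (A + ε / 2) ≤ ‖u • ξ + s • e‖ ^ 2 := by
      refine le_trans ?_ (near u s hu.le hs.le hus)
      nlinarith [mul_le_mul_of_nonneg_right (pow_le_pow_left₀ hu.le hus 2) hε.le]
    have h2 := Real.rpow_le_rpow_of_nonpos (by positivity) h1 hα2
    rw [rpow_neg_half_sq_mul hu (by positivity)] at h2
    have h3 : s ^ (-α) ≤ u ^ (-α) := Real.rpow_le_rpow_of_nonpos hu hus (by linarith)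
    have h4 : 0 ≤ A ^ (-(α / 2)) - (A + ε / 2) ^ (-(α / 2)) :=
      sub_nonneg.2 (Real.rpow_le_rpow_of_nonpos hA (by linarith) hα2)
    nlinarith [mul_le_mul_of_nonneg_left h3 h4]
  · rw [div_norm_rpow_eq, div_norm_rpow_eq, one_mul, one_mul, norm_smul, mul_pow,
      Real.norm_eq_abs, sq_abs, ← hAdef, rpow_neg_half_sq_mul hu hA.le]
    have hx0 : 0 ≤ 2 * η * (s / u) := by positivity
    have hsu1 : s / u ≤ 1 := (div_le_one hu).2 hsu
    have hx1 : 2 * η * (s / u) ≤ A / 2 := by nlinarith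
    have h1 : u ^ 2 * (A - 2 * η * (s / u)) ≤ ‖u • ξ + s • e‖ ^ 2 := by
      refine le_trans (le_of_eq_of_le ?_ (le_add_of_nonneg_right (by positivity)))
        (key u s hu.le hs.le)
      field_simp
    have h2 := Real.rpow_le_rpow_of_nonpos (mul_pos (by positivity) (by linarith)) h1 hα2
    rw [rpow_neg_half_sq_mul hu (by linarith)] at h2
    have h3 := hCx _ hx0 hx1
    have h4 : u ^ (-(α + 1)) = u ^ (-α) / u := by
      rw [neg_add, Real.rpow_add hu, Real.rpow_neg_one]; rfl
    have h5 : 2 * C * η * (s * u ^ (-(α + 1))) = u ^ (-α) * (C * (2 * η * (s / u))) := by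
      rw [h4]; ring
    rw [h5]
    have := mul_le_mul_of_nonneg_left h3 (Real.rpow_pos_of_pos hu (-α)).le
    linarith

/-- A displacement that does not point backwards lowers the attraction at all times. -/
lemma exists_pairBound_of_inner_nonneg {α : ℝ} (hα : 0 < α) {ξ e : V} (hξ : ξ ≠ 0) (he : e ≠ 0)
    (h : 0 ≤ inner ℝ ξ e) : ∃ c, 0 < c ∧ PairBound α ξ e c 0 := by
  have he' : 0 < ‖e‖ ^ 2 := pow_pos (norm_pos_iff.2 he) 2
  obtain ⟨c, C, η₀, hc, -, hη₀, H⟩ := exists_pairBound hα hξ he'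
  refine ⟨c, hc, ?_⟩
  have := H e 0 le_rfl le_rfl hη₀.le (by linarith)
  rwa [mul_zero] at this

lemma PairBound.mono_left {α : ℝ} {ξ e : V} {c c' κ : ℝ} (h : PairBound α ξ e c κ) (hc : c' ≤ c) :
    PairBound α ξ e c' κ := by
  refine ⟨h.ne_zero, fun u s hu hs hus => (h.near u s hu hs hus).trans ?_, h.far⟩
  have := Real.rpow_nonneg hs.le (-α)
  nlinarith

end PairEstimates

/-! ### Standard variations and the potential part of the action -/

section Variation

variable {ι : Type*} [Fintype ι]

lemma euclNorm_smul {s : ℝ} (hs : 0 ≤ s) (e : ι → Plane) : euclNorm (s • e) = s * euclNorm e := by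
  simp only [euclNorm, Pi.smul_apply, norm_smul, mul_pow, ← Finset.mul_sum, Real.norm_eq_abs,
    sq_abs]
  rw [Real.sqrt_mul (sq_nonneg s), Real.sqrt_sq hs]

lemma euclNorm_pos {e : ι → Plane} {i : ι} (h : e i ≠ 0) : 0 < euclNorm e := by
  refine Real.sqrt_pos.2 (Finset.sum_pos' (fun j _ => sq_nonneg _) ⟨i, Finset.mem_univ i, ?_⟩)
  have := norm_pos_iff.2 h
  positivity

/-- The scalar profile of the standard variation: for `0 < s` and `s N < T`, where `N` is the length
of `e`, the standard variation associated to `s e` and `T` is `profile N T s |t| • e`. -/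
noncomputable def profile (N T s t : ℝ) : ℝ := max 0 (min s ((T - t) / N))

lemma continuous_profile (N T s : ℝ) : Continuous (profile N T s) := by
  unfold profile
  fun_prop

lemma profile_nonneg (N T s t : ℝ) : 0 ≤ profile N T s t := le_max_left _ _

lemma profile_le {N T s t : ℝ} (hs : 0 ≤ s) : profile N T s t ≤ s := max_le hs (min_le_left _ _)

lemma profile_pos {N T s t : ℝ} (hN : 0 < N) (hs : 0 < s) (ht : t < T) : 0 < profile N T s t :=
  lt_max_of_lt_right (lt_min hs (div_pos (by linarith) hN))

lemma profile_eq_left {N T s t : ℝ} (hN : 0 < N) (hs : 0 ≤ s) (ht : t ≤ T - s * N) :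
    profile N T s t = s := by
  have : s ≤ (T - t) / N := (le_div_iff₀ hN).2 (by linarith)
  rw [profile, min_eq_left this, max_eq_right hs]

lemma profile_eq_middle {N T s t : ℝ} (hN : 0 < N) (h₁ : T - s * N ≤ t) (h₂ : t ≤ T) :
    profile N T s t = (T - t) / N := by
  have : (T - t) / N ≤ s := (div_le_iff₀ hN).2 (by linarith)
  rw [profile, min_eq_right this, max_eq_right (div_nonneg (by linarith) hN.le)]

lemma profile_eq_zero {N T s t : ℝ} (hN : 0 < N) (ht : T ≤ t) : profile N T s t = 0 := by
  have : (T - t) / N ≤ 0 := div_nonpos_of_nonpos_of_nonneg (by linarith) hN.le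
  rw [profile, max_eq_left ((min_le_right _ _).trans this)]

lemma standardVariation_smul {e : ι → Plane} {s T : ℝ} (hN : 0 < euclNorm e) (hs : 0 < s) (t : ℝ) :
    standardVariation (s • e) T t = profile (euclNorm e) T s |t| • e := by
  rw [standardVariation, euclNorm_smul hs.le]
  split_ifs with h₁ h₂
  · rw [profile_eq_left hN hs.le h₁]
  · rw [profile_eq_middle hN (not_le.1 h₁).le h₂, smul_smul]
    congr 1
    field_simp
  · rw [profile_eq_zero hN (not_le.1 h₂).le, zero_smul]

lemma standardVariation_neg (δ : ι → Plane) (T t : ℝ) :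
    standardVariation δ T (-t) = standardVariation δ T t := by
  simp only [standardVariation, abs_neg]

/-- The slope of the profile. -/
noncomputable def profileSlope (N T s t : ℝ) : ℝ := (Set.Ioo (T - s * N) T).indicator (fun _ => -N⁻¹) t

lemma hasDerivAt_profile {N T s t : ℝ} (hN : 0 < N) (hs : 0 < s) (h₁ : t ≠ T - s * N)
    (h₂ : t ≠ T) : HasDerivAt (profile N T s) (profileSlope N T s t) t := by
  have hsN : 0 < s * N := mul_pos hs hN
  rcases lt_or_gt_of_ne h₁ with h | h
  · rw [profileSlope, Set.indicator_of_notMem (fun hm => by linarith [hm.1])]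
    refine (hasDerivAt_const t s).congr_of_eventuallyEq ?_
    filter_upwards [Iio_mem_nhds h] with x hx
    exact profile_eq_left hN hs.le (le_of_lt hx)
  rcases lt_or_gt_of_ne h₂ with h' | h'
  · rw [profileSlope, Set.indicator_of_mem (show t ∈ Set.Ioo _ _ from ⟨h, h'⟩)]
    have h3 : HasDerivAt (fun x : ℝ => (T - x) / N) (-1 / N) t :=
      ((hasDerivAt_id t).const_sub T).div_const N
    rw [show -N⁻¹ = -1 / N by field_simp]
    refine h3.congr_of_eventuallyEq ?_
    filter_upwards [Ioo_mem_nhds h h'] with x hx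
    exact profile_eq_middle hN hx.1.le hx.2.le
  · rw [profileSlope, Set.indicator_of_notMem (fun hm => by linarith [hm.2])]
    refine (hasDerivAt_const t (0 : ℝ)).congr_of_eventuallyEq ?_
    filter_upwards [Ioi_mem_nhds h'] with x hx
    exact profile_eq_zero hN (le_of_lt hx)

lemma kinetic_neg (m : ι → ℝ) (v : ι → Plane) : kinetic m (-v) = kinetic m v := by
  simp [kinetic]

variable [LinearOrder ι]

/-- Reversing time exchanges the ejection branch and the collision branch. -/
lemma lagrangianVariation_neg (α : ℝ) (m : ι → ℝ) (q φ : ℝ → ι → Plane) (t : ℝ) :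
    lagrangianVariation α m q φ (-t) =
      lagrangianVariation α m (fun t => q (-t)) (fun t => φ (-t)) t := by
  have h1 : deriv (fun t => q (-t)) t = -deriv q (-t) := deriv_comp_neg q t
  have h2 : deriv ((fun t => q (-t)) + fun t => φ (-t)) t = -deriv (q + φ) (-t) :=
    deriv_comp_neg (q + φ) t
  simp only [lagrangianVariation, lagrangian, h1, h2, kinetic_neg]
  rfl

lemma potential_smul {α : ℝ} (m : ι → ℝ) (x : ι → Plane) {u : ℝ} (hu : 0 < u) :
    potential α m (u • x) = u ^ (-α) * potential α m x := by
  simp only [potential, Finset.mul_sum, Pi.smul_apply, ← smul_sub, norm_smul, Real.norm_eq_abs,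
    abs_of_pos hu]
  refine Finset.sum_congr rfl fun i _ => Finset.sum_congr rfl fun j _ => ?_
  rw [Real.mul_rpow hu.le (norm_nonneg _), Real.rpow_neg hu.le]
  rw [div_mul_eq_div_div, div_right_comm, div_eq_inv_mul]

lemma continuousOn_potential {α : ℝ} (m : ι → ℝ) {f : ℝ → ι → Plane} {S : Set ℝ}
    (hf : ContinuousOn f S) (h : ∀ t ∈ S, ∀ i j, i ≠ j → f t i - f t j ≠ 0) :
    ContinuousOn (fun t => potential α m (f t)) S := by
  have hfi : ∀ i, ContinuousOn (fun t => f t i) S := fun i => continuousOn_pi.1 hf i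
  refine continuousOn_finsetSum _ fun i _ => continuousOn_finsetSum _ fun j hj => ?_
  have hij : i ≠ j := (Finset.mem_filter.1 hj).2.ne
  have hn : ∀ t ∈ S, ‖f t i - f t j‖ ≠ 0 := fun t ht => norm_ne_zero_iff.2 (h t ht i j hij)
  refine ContinuousOn.div continuousOn_const ?_ ?_
  · exact ((hfi i).sub (hfi j)).norm.rpow_const fun t ht => Or.inl (hn t ht)
  · intro t ht
    exact (Real.rpow_pos_of_pos (lt_of_le_of_ne (norm_nonneg _) (hn t ht).symm) _).ne'

/-- `e` is a direction of descent at the total collision for the branch `t ^ (2 / (2 + α)) ξ`: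
displacing `u ξ` by `s e` produces no collision, lowers the potential by at least `c s ^ (-α)` as
long as `u ≤ s`, and for `s ≤ u` raises it by at most `κ s u ^ (-(α + 1))`, with `κ` so small
that the gain outweighs the loss after integration in time. -/
structure DescentDirection (α : ℝ) (m : ι → ℝ) (ξ e : ι → Plane) : Prop where
  separated : ∀ i j, i ≠ j → ∀ u s : ℝ, 0 ≤ u → 0 ≤ s → 0 < u + s →
    u • (ξ i - ξ j) + s • (e i - e j) ≠ 0
  bounds : ∃ c κ : ℝ, 0 ≤ κ ∧ κ * ((2 + α) / α) < c ∧ ∀ u s : ℝ, 0 < u → 0 < s →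
    (u ≤ s → potential α m (u • ξ + s • e) - potential α m (u • ξ) ≤ -c * s ^ (-α)) ∧
    (s ≤ u → potential α m (u • ξ + s • e) - potential α m (u • ξ) ≤ κ * (s * u ^ (-(α + 1))))

lemma DescentDirection.sub_ne_zero {α : ℝ} {m : ι → ℝ} {ξ e : ι → Plane}
    (h : DescentDirection α m ξ e) {u s : ℝ} (hu : 0 ≤ u) (hs : 0 ≤ s) (hus : 0 < u + s) {i j : ι}
    (hij : i ≠ j) : (u • ξ + s • e) i - (u • ξ + s • e) j ≠ 0 := by
  have := h.separated i j hij u s hu hs hus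
  simp only [Pi.add_apply, Pi.smul_apply]
  rwa [show u • ξ i + s • e i - (u • ξ j + s • e j) = u • (ξ i - ξ j) + s • (e i - e j) by
    module]

/-- The difference of the potentials along the varied and the original branch. -/
noncomputable def potentialDiff (α : ℝ) (m : ι → ℝ) (ξ e : ι → Plane) (N T s t : ℝ) : ℝ :=
  potential α m (t ^ (2 / (2 + α)) • ξ + profile N T s t • e) -
    potential α m (t ^ (2 / (2 + α)) • ξ)

lemma potentialDiff_of_le {α : ℝ} {m : ι → ℝ} {ξ e : ι → Plane} {N T s t : ℝ} (hN : 0 < N)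
    (ht : T ≤ t) : potentialDiff α m ξ e N T s t = 0 := by
  rw [potentialDiff, profile_eq_zero hN ht, zero_smul, add_zero, sub_self]

lemma integrableOn_potentialDiff {α : ℝ} (hα₀ : 0 < α) (hα₂ : α < 2) {m : ι → ℝ}
    {ξ e : ι → Plane} (h : DescentDirection α m ξ e) {N T s : ℝ} (hN : 0 < N) (hT : 0 < T)
    (hs : 0 < s) : IntegrableOn (potentialDiff α m ξ e N T s) (Set.Ioi 0) := by
  have hβ : 0 < 2 / (2 + α) := by positivity
  rw [← Set.Ioc_union_Ioi_eq_Ioi hT.le]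
  refine IntegrableOn.union ?_ ?_
  · refine IntegrableOn.sub ?_ ?_
    · refine (ContinuousOn.integrableOn_Icc ?_).mono_set Set.Ioc_subset_Icc_self
      refine continuousOn_potential m ?_ ?_
      · refine Continuous.continuousOn ?_
        exact ((Real.continuous_rpow_const hβ.le).smul continuous_const).add
          ((continuous_profile N T s).smul continuous_const)
      · intro t ht i j hij
        refine h.sub_ne_zero (Real.rpow_nonneg ht.1 _) (profile_nonneg _ _ _ _) ?_ hij
        rcases eq_or_lt_of_le ht.2 with h' | h'
        · exact add_pos_of_pos_of_nonneg (Real.rpow_pos_of_pos (h' ▸ hT) _) (profile_nonneg _ _ _ _)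
        · exact add_pos_of_nonneg_of_pos (Real.rpow_nonneg ht.1 _) (profile_pos hN hs h')
    · have h1 : -1 < 2 / (2 + α) * (-α) := by
        rw [div_mul_eq_mul_div, lt_div_iff₀ (by linarith)]
        linarith
      have h2 := (intervalIntegral.intervalIntegrable_rpow' (a := 0) (b := T) h1).1
      refine IntegrableOn.congr_fun (h2.mul_const (potential α m ξ)) ?_ measurableSet_Ioc
      intro t ht
      have ht0 : 0 < t := ht.1
      simp only
      rw [potential_smul m ξ (Real.rpow_pos_of_pos ht0 _), ← Real.rpow_mul ht0.le]
  · refine IntegrableOn.congr_fun integrableOn_zero ?_ measurableSet_Ioi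
    intro t ht
    exact (potentialDiff_of_le hN (le_of_lt ht)).symm

/-- The contribution of the potential: the gain near the collision, at the times with
`t ^ (2 / (2 + α)) ≤ s`, is of order `s ^ (1 - α / 2)`, and so is the loss afterwards. -/
lemma exists_integral_potentialDiff_le {α : ℝ} (hα₀ : 0 < α) (hα₂ : α < 2) {m : ι → ℝ}
    {ξ e : ι → Plane} (h : DescentDirection α m ξ e) :
    ∃ c : ℝ, 0 < c ∧ ∀ N T s : ℝ, 0 < N → 0 < T → 0 < s → s ≤ 1 → s ≤ T / 2 → s * N ≤ T / 2 →
      ∫ t in Set.Ioi 0, potentialDiff α m ξ e N T s t ≤ -c * s ^ (1 - α / 2) := by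
  obtain ⟨c, κ, hκ, hc, hb⟩ := h.bounds
  refine ⟨c - κ * ((2 + α) / α), sub_pos.2 hc, fun N T s hN hT hs hs1 hsT hsN => ?_⟩
  have hα' : 0 < 2 + α := by linarith
  set β := 2 / (2 + α) with hβdef
  have hβ : 0 < β := by positivity
  -- At the time `a` the unperturbed motion has moved as far as the displacement `s`.
  set a := s ^ (1 + α / 2) with hadef
  have ha : 0 < a := Real.rpow_pos_of_pos hs _
  have haβ : a ^ β = s := by
    rw [hadef, ← Real.rpow_mul hs.le]
    have : (1 + α / 2) * β = 1 := by rw [hβdef]; field_simp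
    rw [this, Real.rpow_one]
  have haT : a ≤ T / 2 := by
    refine le_trans ?_ hsT
    have := Real.rpow_le_rpow_of_exponent_ge hs hs1 (by linarith : (1 : ℝ) ≤ 1 + α / 2)
    rwa [Real.rpow_one] at this
  have hint := integrableOn_potentialDiff hα₀ hα₂ h hN hT hs
  set p := β * (-(α + 1)) with hpdef
  have hp : p + 1 = -(α / (2 + α)) := by rw [hpdef, hβdef]; field_simp; ring
  have hp1 : p < -1 := by
    have : 0 < α / (2 + α) := by positivity
    linarith
  have hnear : ∫ t in Set.Ioc 0 a, potentialDiff α m ξ e N T s t ≤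
      ∫ _ in Set.Ioc 0 a, -c * s ^ (-α) := by
    refine setIntegral_mono_on (hint.mono_set Set.Ioc_subset_Ioi_self)
      (integrableOn_const (by simp)) measurableSet_Ioc fun t ht => ?_
    rw [potentialDiff, profile_eq_left hN hs.le (by linarith [ht.2])]
    refine (hb _ s (Real.rpow_pos_of_pos ht.1 _) hs).1 ?_
    rw [← haβ]
    exact Real.rpow_le_rpow ht.1.le ht.2 hβ.le
  have hfar : ∫ t in Set.Ioi a, potentialDiff α m ξ e N T s t ≤
      ∫ t in Set.Ioi a, κ * s * t ^ p := by
    refine setIntegral_mono_on (hint.mono_set (Set.Ioi_subset_Ioi ha.le))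
      ((integrableOn_Ioi_rpow_of_lt hp1 ha).const_mul _) measurableSet_Ioi fun t ht => ?_
    have ht' : a < t := ht
    have ht0 : 0 < t := ha.trans ht
    rcases le_or_gt T t with hTt | hTt
    · rw [potentialDiff_of_le hN hTt]
      exact mul_nonneg (mul_nonneg hκ hs.le) (Real.rpow_nonneg ht0.le _)
    · have hst : s ≤ t ^ β := by
        rw [← haβ]
        exact Real.rpow_le_rpow ha.le ht'.le hβ.le
      have hle : profile N T s t ≤ s := profile_le hs.le
      refine ((hb _ _ (Real.rpow_pos_of_pos ht0 _) (profile_pos hN hs hTt)).2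
        (hle.trans hst)).trans ?_
      rw [← Real.rpow_mul ht0.le, mul_assoc]
      have := Real.rpow_nonneg ht0.le p
      gcongr
  rw [← Set.Ioc_union_Ioi_eq_Ioi ha.le, setIntegral_union (Set.Ioc_disjoint_Ioi le_rfl)
    measurableSet_Ioi (hint.mono_set Set.Ioc_subset_Ioi_self)
    (hint.mono_set (Set.Ioi_subset_Ioi ha.le))]
  refine (add_le_add hnear hfar).trans (le_of_eq ?_)
  rw [setIntegral_const, integral_const_mul, integral_Ioi_rpow_of_lt hp1 ha, hp]
  have h1 : a ^ (-(α / (2 + α))) = s ^ (-(α / 2)) := by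
    rw [hadef, ← Real.rpow_mul hs.le]
    congr 1
    field_simp
  have h2 : s * s ^ (-(α / 2)) = s ^ (1 - α / 2) := by
    rw [sub_eq_add_neg, Real.rpow_add hs, Real.rpow_one]
  have h3 : a * s ^ (-α) = s ^ (1 - α / 2) := by
    rw [hadef, ← Real.rpow_add hs]
    congr 1
    ring
  rw [h1]
  have h4 : (volume.real (Set.Ioc 0 a)) = a := by
    rw [Real.volume_real_Ioc_of_le ha.le, sub_zero]
  rw [h4, smul_eq_mul]
  calc a * (-c * s ^ (-α)) + κ * s * (-s ^ (-(α / 2)) / -(α / (2 + α)))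
      = -c * (a * s ^ (-α)) + κ * ((2 + α) / α) * (s * s ^ (-(α / 2))) := by
        field_simp
    _ = _ := by rw [h2, h3]; ring

end Variation

/-! ### The variation of the action -/

section ActionEstimate

variable {ι : Type*} [Fintype ι]

/-- The change of the kinetic energy while the profile decreases with slope `-1 / N`. -/
noncomputable def kineticDiff (α : ℝ) (m : ι → ℝ) (ξ e : ι → Plane) (N t : ℝ) : ℝ :=
  kinetic m ((2 / (2 + α) * t ^ (2 / (2 + α) - 1)) • ξ + (-N⁻¹) • e) -
    kinetic m ((2 / (2 + α) * t ^ (2 / (2 + α) - 1)) • ξ)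

lemma continuousOn_kineticDiff (α : ℝ) (m : ι → ℝ) (ξ e : ι → Plane) (N : ℝ) {S : Set ℝ}
    (hS : ∀ t ∈ S, t ≠ 0) : ContinuousOn (kineticDiff α m ξ e N) S := by
  have h1 : ContinuousOn (fun t : ℝ => 2 / (2 + α) * t ^ (2 / (2 + α) - 1)) S :=
    continuousOn_const.mul (continuousOn_id.rpow_const fun t ht => Or.inl (hS t ht))
  unfold kineticDiff kinetic
  simp only [Pi.add_apply, Pi.smul_apply]
  refine ContinuousOn.sub ?_ ?_
  · refine continuousOn_const.mul (continuousOn_finsetSum _ fun i _ => continuousOn_const.mul ?_)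
    exact ((h1.smul continuousOn_const).add continuousOn_const).norm.pow 2
  · refine continuousOn_const.mul (continuousOn_finsetSum _ fun i _ => continuousOn_const.mul ?_)
    exact (h1.smul continuousOn_const).norm.pow 2

/-- The standard variations belong to `H¹`. -/
lemma memH1_standardVariation {e : ι → Plane} (hN : 0 < euclNorm e) {T s : ℝ} (hs : 0 < s)
    (hT : s * euclNorm e < T) : MemH1 (standardVariation (s • e) T) := by
  set N := euclNorm e with hNdef
  have hv : standardVariation (s • e) T = fun t => profile N T s |t| • e :=
    funext fun t => standardVariation_smul hN hs t
  have hsN : 0 < s * N := mul_pos hs hN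
  have hcont : Continuous (standardVariation (s • e) T) := by
    rw [hv]
    exact ((continuous_profile N T s).comp continuous_abs).smul continuous_const
  set ψ : ℝ → ι → Plane := fun t =>
    ((Set.Ioo (T - s * N) T).indicator (fun _ => -N⁻¹) t -
      (Set.Ioo (-T) (-(T - s * N))).indicator (fun _ => -N⁻¹) t) • e with hψ
  have hψmem : MemLp ψ 2 volume := by
    have h1 : ∀ a b : ℝ, MemLp ((Set.Ioo a b).indicator fun _ : ℝ => -N⁻¹ • e) 2 volume :=
      fun a b => memLp_indicator_const 2 measurableSet_Ioo _ (Or.inr (by simp))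
    have h2 : ψ = (Set.Ioo (T - s * N) T).indicator (fun _ => -N⁻¹ • e) -
        (Set.Ioo (-T) (-(T - s * N))).indicator (fun _ => -N⁻¹ • e) := by
      funext t
      rw [hψ, Pi.sub_apply]
      simp only [sub_smul, Set.indicator_apply, ite_smul, zero_smul]
    rw [h2]
    exact (h1 _ _).sub (h1 _ _)
  refine ⟨hcont.memLp_of_hasCompactSupport ?_, ψ, hψmem, fun t => ?_⟩
  · refine HasCompactSupport.intro (isCompact_Icc (a := -T) (b := T)) fun t ht => ?_
    rw [hv]
    have : T ≤ |t| := by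
      by_contra! hlt
      exact ht ⟨(abs_lt.1 hlt).1.le, (abs_lt.1 hlt).2.le⟩
    simp only [profile_eq_zero hN this, zero_smul]
  · have hderiv : ∀ x ∉ ({0, T - s * N, T, -(T - s * N), -T} : Set ℝ),
        HasDerivAt (standardVariation (s • e) T) (ψ x) x := by
      intro x hx
      simp only [Set.mem_insert_iff, Set.mem_singleton_iff, not_or] at hx
      obtain ⟨h0, h1, h2, h3, h4⟩ := hx
      rw [hv]
      refine HasDerivAt.smul_const ?_ e
      rcases lt_or_gt_of_ne h0 with hneg | hpos
      · have h := (hasDerivAt_profile (T := T) (t := -x) hN hs (fun h => h3 (by linarith))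
          (fun h => h4 (by linarith))).comp x (hasDerivAt_neg x)
        have hmem : -x ∈ Set.Ioo (T - s * N) T ↔ x ∈ Set.Ioo (-T) (-(T - s * N)) :=
          ⟨fun h => ⟨by linarith [h.2], by linarith [h.1]⟩,
            fun h => ⟨by linarith [h.2], by linarith [h.1]⟩⟩
        have hnm : x ∉ Set.Ioo (T - s * N) T := fun h => by linarith [h.1]
        refine (h.congr_deriv ?_).congr_of_eventuallyEq ?_
        · rw [Set.indicator_of_notMem hnm, profileSlope]
          by_cases hm : -x ∈ Set.Ioo (T - s * N) T
          · rw [Set.indicator_of_mem hm, Set.indicator_of_mem (hmem.1 hm)]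
            ring
          · rw [Set.indicator_of_notMem hm, Set.indicator_of_notMem (fun h => hm (hmem.2 h))]
            ring
        · filter_upwards [Iio_mem_nhds hneg] with y hy
          simp only [Function.comp_apply, abs_of_neg (show y < 0 from hy)]
      · have h := hasDerivAt_profile hN hs h1 h2
        have hnm : x ∉ Set.Ioo (-T) (-(T - s * N)) := fun h => by linarith [h.2]
        refine (h.congr_deriv ?_).congr_of_eventuallyEq ?_
        · rw [Set.indicator_of_notMem hnm, profileSlope, sub_zero]
        · filter_upwards [Ioi_mem_nhds hpos] with y hy
          simp only [abs_of_pos (show 0 < y from hy)]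
    have := integral_eq_of_hasDerivAt_off_countable (standardVariation (s • e) T) ψ (a := 0)
      (b := t) (Set.Finite.countable (by simp : ({0, T - s * N, T, -(T - s * N), -T} : Set ℝ).Finite))
      hcont.continuousOn (fun x hx => hderiv x hx.2)
      ((hψmem.locallyIntegrable (by norm_num)).integrableOn_isCompact isCompact_uIcc).intervalIntegrable
    rw [this]
    abel

variable [LinearOrder ι]

lemma lagrangianVariation_standardVariation {α : ℝ} {m : ι → ℝ} {ξ e : ι → Plane}
    {q : ℝ → ι → Plane} (hq : ∀ t : ℝ, 0 ≤ t → ∀ i, q t i = |t| ^ (2 / (2 + α)) • ξ i)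
    (hN : 0 < euclNorm e) {T s t : ℝ} (hs : 0 < s) (ht : 0 < t)
    (h₁ : t ≠ T - s * euclNorm e) (h₂ : t ≠ T) :
    lagrangianVariation α m q (standardVariation (s • e) T) t =
      potentialDiff α m ξ e (euclNorm e) T s t +
        (Set.Ioo (T - s * euclNorm e) T).indicator (kineticDiff α m ξ e (euclNorm e)) t := by
  have hqt : ∀ x : ℝ, 0 < x → q x = x ^ (2 / (2 + α)) • ξ := fun x hx => by
    funext i
    rw [hq x hx.le i, abs_of_pos hx, Pi.smul_apply]
  have hvt : ∀ x : ℝ, 0 < x →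
      standardVariation (s • e) T x = profile (euclNorm e) T s x • e := fun x hx => by
    rw [standardVariation_smul hN hs, abs_of_pos hx]
  have hdq : HasDerivAt q ((2 / (2 + α) * t ^ (2 / (2 + α) - 1)) • ξ) t := by
    refine ((Real.hasDerivAt_rpow_const (Or.inl ht.ne')).smul_const ξ).congr_of_eventuallyEq ?_
    filter_upwards [Ioi_mem_nhds ht] with x hx using hqt x hx
  have hdv : HasDerivAt (standardVariation (s • e) T) (profileSlope (euclNorm e) T s t • e) t := by
    refine ((hasDerivAt_profile hN hs h₁ h₂).smul_const e).congr_of_eventuallyEq ?_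
    filter_upwards [Ioi_mem_nhds ht] with x hx using hvt x hx
  rw [lagrangianVariation, lagrangian, lagrangian, (hdq.add hdv).deriv, hdq.deriv, Pi.add_apply,
    hqt t ht, hvt t ht, potentialDiff]
  by_cases hm : t ∈ Set.Ioo (T - s * euclNorm e) T
  · rw [profileSlope, Set.indicator_of_mem hm, Set.indicator_of_mem hm, kineticDiff]
    ring
  · rw [profileSlope, Set.indicator_of_notMem hm, Set.indicator_of_notMem hm, zero_smul, add_zero]
    ring

/-- The variation of the action along the ejection branch: the potential contributes at most a
negative multiple of `s ^ (1 - α / 2)`, and the kinetic energy a term of order `s`. -/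
lemma exists_integral_ejection_le {α : ℝ} (hα₀ : 0 < α) (hα₂ : α < 2) {m : ι → ℝ}
    {ξ e : ι → Plane} (h : DescentDirection α m ξ e) (hN : 0 < euclNorm e) {T : ℝ} (hT : 0 < T) :
    ∃ c K : ℝ, 0 < c ∧ ∀ s : ℝ, 0 < s → s ≤ 1 → s ≤ T / 2 → s * euclNorm e ≤ T / 2 →
      ∀ q : ℝ → ι → Plane, (∀ t : ℝ, 0 ≤ t → ∀ i, q t i = |t| ^ (2 / (2 + α)) • ξ i) →
      IntegrableOn (lagrangianVariation α m q (standardVariation (s • e) T)) (Set.Ioi 0) ∧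
      ∫ t in Set.Ioi 0, lagrangianVariation α m q (standardVariation (s • e) T) t ≤
        -c * s ^ (1 - α / 2) + K * s := by
  obtain ⟨c, hc, hcs⟩ := exists_integral_potentialDiff_le hα₀ hα₂ h
  set N := euclNorm e with hNdef
  have hcont : ContinuousOn (kineticDiff α m ξ e N) (Set.Icc (T / 2) T) :=
    continuousOn_kineticDiff α m ξ e N fun t ht => by linarith [ht.1]
  obtain ⟨K, hK⟩ := isCompact_Icc.exists_bound_of_continuousOn hcont
  refine ⟨c, K * N, hc, fun s hs hs1 hsT hsN q hq => ?_⟩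
  have hsN0 : 0 < s * N := mul_pos hs hN
  set J := Set.Ioo (T - s * N) T with hJ
  have hJT : J ⊆ Set.Icc (T / 2) T := fun t ht => ⟨by linarith [ht.1], ht.2.le⟩
  have hJ0 : J ⊆ Set.Ioi 0 := fun t ht => by
    have := (hJT ht).1
    exact lt_of_lt_of_le (by linarith) this
  have hpot := integrableOn_potentialDiff hα₀ hα₂ h hN hT hs
  have hkinJ : IntegrableOn (kineticDiff α m ξ e N) J := hcont.integrableOn_Icc.mono_set hJT
  have hkin : IntegrableOn (J.indicator (kineticDiff α m ξ e N)) (Set.Ioi 0) :=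
    ((integrable_indicator_iff measurableSet_Ioo).2 hkinJ).integrableOn
  have hae : (fun t => potentialDiff α m ξ e N T s t + J.indicator (kineticDiff α m ξ e N) t)
      =ᵐ[volume.restrict (Set.Ioi 0)]
      lagrangianVariation α m q (standardVariation (s • e) T) := by
    filter_upwards [ae_restrict_mem measurableSet_Ioi, Measure.ae_ne _ (T - s * N),
      Measure.ae_ne _ T] with t ht h1 h2
    exact (lagrangianVariation_standardVariation hq hN hs ht h1 h2).symm
  refine ⟨(hpot.add hkin).congr hae, ?_⟩
  rw [← integral_congr_ae hae, integral_add hpot hkin]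
  refine add_le_add (hcs N T s hN hT hs hs1 hsT hsN) ?_
  rw [setIntegral_indicator measurableSet_Ioo, Set.inter_eq_right.2 hJ0]
  refine (le_abs_self _).trans ?_
  have h1 := norm_setIntegral_le_of_norm_le_const (μ := volume) (s := J)
    (f := kineticDiff α m ξ e N) (C := K) (by simp [hJ]) fun t ht => hK t (hJT ht)
  rw [Real.norm_eq_abs] at h1
  refine h1.trans (le_of_eq ?_)
  rw [hJ, Real.volume_real_Ioo_of_le (by linarith)]
  ring

/-- If `e` is a direction of descent for both branches, then the standard variations associated to
`s e` lower the action for all small `s > 0`, because `1 - α / 2 < 1`. -/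
lemma eventually_actionVariation_neg {α : ℝ} (hα₀ : 0 < α) (hα₂ : α < 2) {m : ι → ℝ}
    {ξp ξn e : ι → Plane} (hp : DescentDirection α m ξp e) (hn : DescentDirection α m ξn e)
    (hN : 0 < euclNorm e) {q : ℝ → ι → Plane}
    (hqp : ∀ t : ℝ, 0 ≤ t → ∀ i, q t i = |t| ^ (2 / (2 + α)) • ξp i)
    (hqn : ∀ t : ℝ, t ≤ 0 → ∀ i, q t i = |t| ^ (2 / (2 + α)) • ξn i) {T : ℝ} (hT : 0 < T) :
    ∀ᶠ s in nhdsWithin (0 : ℝ) (Set.Ioi 0),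
      Integrable (lagrangianVariation α m q (standardVariation (s • e) T)) ∧
      actionVariation α m q (standardVariation (s • e) T) < 0 := by
  obtain ⟨c₁, K₁, hc₁, H₁⟩ := exists_integral_ejection_le hα₀ hα₂ hp hN hT
  obtain ⟨c₂, K₂, hc₂, H₂⟩ := exists_integral_ejection_le hα₀ hα₂ hn hN hT
  have hlim : Filter.Tendsto (fun s : ℝ => (K₁ + K₂) * s ^ (α / 2)) (nhdsWithin 0 (Set.Ioi 0))
      (nhds 0) := by
    have h1 : Continuous fun s : ℝ => (K₁ + K₂) * s ^ (α / 2) :=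
      continuous_const.mul (Real.continuous_rpow_const (by positivity))
    have h2 := h1.tendsto 0
    rw [Real.zero_rpow (by positivity), mul_zero] at h2
    exact h2.mono_left nhdsWithin_le_nhds
  have hsmall : ∀ b : ℝ, 0 < b → ∀ᶠ s in nhdsWithin (0 : ℝ) (Set.Ioi 0), s ≤ b := fun b hb =>
    nhdsWithin_le_nhds (Iic_mem_nhds hb)
  filter_upwards [self_mem_nhdsWithin, hsmall 1 one_pos, hsmall (T / 2) (by positivity),
    hsmall (T / 2 / euclNorm e) (by positivity), hlim.eventually_lt_const (add_pos hc₁ hc₂)]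
    with s hs hs1 hsT hsN hsK
  have hs0 : 0 < s := hs
  rw [le_div_iff₀ hN] at hsN
  obtain ⟨i₁, h₁⟩ := H₁ s hs hs1 hsT hsN q hqp
  obtain ⟨i₂, h₂⟩ := H₂ s hs hs1 hsT hsN (fun t => q (-t)) fun t ht i => by
    simpa only [abs_neg] using hqn (-t) (by linarith) i
  generalize hf : lagrangianVariation α m q (standardVariation (s • e) T) = f at *
  have hneg : ∀ t, lagrangianVariation α m (fun t => q (-t)) (standardVariation (s • e) T) t =
      f (-t) := fun t => by
    rw [← hf, lagrangianVariation_neg]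
    simp only [standardVariation_neg]
  have i₂' : IntegrableOn (fun t => f (-t)) (Set.Ioi 0) := by
    refine i₂.congr_fun (fun t _ => hneg t) measurableSet_Ioi
  have i₃ : IntegrableOn f (Set.Iic 0) := by
    rw [integrableOn_Iic_iff_integrableOn_Iio]
    rw [← neg_zero] at i₂'
    simpa only [neg_neg] using i₂'.comp_neg_Iio
  have hi : Integrable f := by
    rw [← integrableOn_univ, ← Set.Iic_union_Ioi (a := (0 : ℝ))]
    exact i₃.union i₁
  refine ⟨hi, ?_⟩
  have h₃ : ∫ t in Set.Iic 0, f t ≤ -c₂ * s ^ (1 - α / 2) + K₂ * s := by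
    have := integral_comp_neg_Ioi (0 : ℝ) f
    rw [neg_zero] at this
    rw [← this]
    simpa only [hneg] using h₂
  rw [actionVariation, hf, ← intervalIntegral.integral_Iic_add_Ioi i₃ i₁]
  have hsplit : s = s ^ (1 - α / 2) * s ^ (α / 2) := by
    rw [← Real.rpow_add hs0, sub_add_cancel, Real.rpow_one]
  have hpos : 0 < s ^ (1 - α / 2) := Real.rpow_pos_of_pos hs0 _
  calc (∫ t in Set.Iic 0, f t) + ∫ t in Set.Ioi 0, f t
      ≤ -(c₁ + c₂) * s ^ (1 - α / 2) + (K₁ + K₂) * s := by linarith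
    _ = s ^ (1 - α / 2) * ((K₁ + K₂) * s ^ (α / 2) - (c₁ + c₂)) := by
      nth_rewrite 2 [hsplit]
      ring
    _ < 0 := mul_neg_of_pos_of_neg hpos (by linarith)

end ActionEstimate

/-! ### Central configurations -/

section CentralConfigurations

variable {ι : Type*} [Fintype ι]

lemma hasFDerivAt_pair {α : ℝ} (x : ι → Plane) {i j : ι} (hij : x i ≠ x j) (M : ℝ) :
    ∃ L : (ι → Plane) →L[ℝ] ℝ, HasFDerivAt (fun x : ι → Plane => M / ‖x i - x j‖ ^ α) L x ∧
      ∀ v, L v = -α * (M * (‖x i - x j‖ ^ 2) ^ (-(α / 2 + 1)) *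
        inner ℝ (x i - x j) (v i - v j)) := by
  set D : (ι → Plane) →L[ℝ] Plane :=
    ContinuousLinearMap.proj (R := ℝ) (φ := fun _ : ι => Plane) i -
      ContinuousLinearMap.proj (R := ℝ) (φ := fun _ : ι => Plane) j with hD
  have hDx : ∀ v, D v = v i - v j := fun v => rfl
  have h0 : ‖x i - x j‖ ^ 2 ≠ 0 := pow_ne_zero 2 (norm_ne_zero_iff.2 (sub_ne_zero.2 hij))
  have h1 : HasFDerivAt (fun x : ι → Plane => ‖x i - x j‖ ^ 2)
      (2 • (innerSL ℝ (x i - x j)).comp D) x := (D.hasFDerivAt (x := x)).norm_sq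
  have h2 := (h1.rpow_const (p := -(α / 2)) (Or.inl h0)).const_mul M
  refine ⟨_, h2.congr_of_eventuallyEq (Filter.Eventually.of_forall fun y => ?_), fun v => ?_⟩
  · exact div_norm_rpow_eq α (y i - y j) M
  · simp only [smul_apply, ContinuousLinearMap.comp_apply, hDx,
      innerSL_apply_apply, smul_eq_mul, nsmul_eq_mul]
    rw [show -(α / 2) - 1 = -(α / 2 + 1) by ring]
    push_cast
    ring

variable [LinearOrder ι]

/-- The differential of the potential at a configuration without collisions. -/
lemma fderiv_potential_apply {α : ℝ} (m : ι → ℝ) {x : ι → Plane} (hx : ¬ HasCollision x)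
    (v : ι → Plane) : fderiv ℝ (potential α m) x v =
      -α * ∑ i, ∑ j with i < j, m i * m j * (‖x i - x j‖ ^ 2) ^ (-(α / 2 + 1)) *
        inner ℝ (x i - x j) (v i - v j) := by
  have hne : ∀ i j, i < j → x i ≠ x j := fun i j hij h => hx ⟨i, j, hij.ne, h⟩
  have h1 : ∀ i j, ∃ L : (ι → Plane) →L[ℝ] ℝ, i < j →
      HasFDerivAt (fun x : ι → Plane => m i * m j / ‖x i - x j‖ ^ α) L x ∧
      ∀ v, L v = -α * (m i * m j * (‖x i - x j‖ ^ 2) ^ (-(α / 2 + 1)) *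
        inner ℝ (x i - x j) (v i - v j)) := by
    intro i j
    by_cases hij : i < j
    · obtain ⟨L, hL⟩ := hasFDerivAt_pair (α := α) x (hne i j hij) (m i * m j)
      exact ⟨L, fun _ => hL⟩
    · exact ⟨0, fun h => absurd h hij⟩
  choose L hL using h1
  have h2 : HasFDerivAt (potential α m) (∑ i, ∑ j with i < j, L i j) x := by
    unfold potential
    exact HasFDerivAt.fun_sum fun i _ => HasFDerivAt.fun_sum fun j hj =>
      (hL i j (Finset.mem_filter.1 hj).2).1
  rw [h2.fderiv]
  simp only [sum_apply, Finset.mul_sum]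
  refine Finset.sum_congr rfl fun i _ => Finset.sum_congr rfl fun j hj => ?_
  exact (hL i j (Finset.mem_filter.1 hj).2).2 v

/-- The equations of a central configuration, in weak form: on all displacements, the differential
of the potential is a multiple of the differential of the moment of inertia. -/
lemma IsCentralConfiguration.exists_multiplier {α : ℝ} (hα : 0 < α) {m : ι → ℝ}
    {ξ : ι → Plane} (h : IsCentralConfiguration α m ξ) (hM : ∑ i, m i ≠ 0)
    (hI : ∑ i, m i * inner ℝ (ξ i) (ξ i) ≠ 0) :
    ∃ μ : ℝ, ∀ w : ι → Plane,
      ∑ i, ∑ j with i < j, m i * m j * (‖ξ i - ξ j‖ ^ 2) ^ (-(α / 2 + 1)) *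
        inner ℝ (ξ i - ξ j) (w i - w j) = μ * ∑ i, m i * inner ℝ (ξ i) (w i) := by
  obtain ⟨hcol, hcm, hcrit⟩ := h
  set D : (ι → Plane) → ℝ := fun w =>
    ∑ i, ∑ j with i < j, m i * m j * (‖ξ i - ξ j‖ ^ 2) ^ (-(α / 2 + 1)) *
        inner ℝ (ξ i - ξ j) (w i - w j) with hD
  set I := ∑ i, m i * inner ℝ (ξ i) (ξ i) with hIdef
  refine ⟨D ξ / I, fun w => ?_⟩
  -- Project `w` to the tangent space of the ellipsoid.
  set a := (∑ i, m i)⁻¹ • ∑ i, m i • w i with ha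
  set c := (∑ i, m i * inner ℝ (ξ i) (w i)) / I with hc
  set v : ι → Plane := fun i => w i - a - c • ξ i with hv
  have hv1 : ∑ i, m i • v i = 0 := by
    simp only [hv, smul_sub, Finset.sum_sub_distrib, smul_comm (m _) c, ← Finset.smul_sum, hcm,
      ← Finset.sum_smul]
    rw [ha, smul_smul, mul_inv_cancel₀ hM, one_smul, smul_zero, sub_self, sub_zero]
  have hcm' : ∑ i, m i * inner ℝ (ξ i) a = 0 := by
    have := congrArg (fun z => inner ℝ z a) hcm
    simpa only [sum_inner, inner_smul_left, conj_trivial, inner_zero_left] using this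
  have hv2 : ∑ i, m i * inner ℝ (ξ i) (v i) = 0 := by
    simp only [hv, inner_sub_right, inner_smul_right, mul_sub, Finset.sum_sub_distrib, hcm',
      mul_left_comm (m _) c, ← Finset.mul_sum]
    rw [← hIdef, hc, div_mul_cancel₀ _ hI]
    ring
  have hDv : D v = D w - c * D ξ := by
    simp only [hD, Finset.mul_sum, ← Finset.sum_sub_distrib]
    refine Finset.sum_congr rfl fun i _ => Finset.sum_congr rfl fun j _ => ?_
    have : v i - v j = w i - w j - c • (ξ i - ξ j) := by
      simp only [hv]
      module
    rw [this, inner_sub_right, inner_smul_right]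
    ring
  have h0 := hcrit v hv1 hv2
  rw [fderiv_potential_apply m hcol v] at h0
  have h1 : D v = 0 := (mul_eq_zero.1 h0).resolve_left (by linarith)
  rw [hDv, sub_eq_zero] at h1
  change D w = _
  rw [h1, hc]
  ring

end CentralConfigurations

/-! ### Three bodies with two equal masses -/

section ThreeBodies

/-- The comparison behind the symmetry of the configurations in which the third body lies between
the other two: `x` and `y` are the positions of the first two bodies relative to the third. -/
lemma not_norm_lt_of_balanced {V : Type*} [NormedAddCommGroup V] [InnerProductSpace ℝ V]
    {γ lam m m₃ : ℝ} (hγ : 1 / 2 < γ) (hm : 0 < m) (hm₃ : 0 < m₃) {x y p : V}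
    (h₁ : ((‖x‖ ^ 2) ^ (-γ) - lam) • x + ((‖y‖ ^ 2) ^ (-γ) - lam) • y = 0)
    (h₂ : (m * ((‖x - y‖ ^ 2) ^ (-γ) - lam)) • (x - y) + (m₃ * ((‖x‖ ^ 2) ^ (-γ) - lam)) • x = 0)
    (hp : inner ℝ p x * inner ℝ p y < 0) : ¬ ‖x‖ < ‖y‖ := by
  intro hlt
  have hx : x ≠ 0 := by rintro rfl; simp at hp
  have hx0 : 0 < ‖x‖ := norm_pos_iff.2 hx
  have hy0 : 0 < ‖y‖ := hx0.trans hlt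
  have hy : y ≠ 0 := norm_pos_iff.1 hy0
  have hdec : ∀ a b δ : ℝ, 0 < a → a < b → 0 < δ → (b ^ 2) ^ (-δ) < (a ^ 2) ^ (-δ) :=
    fun a b δ ha hab hδ => Real.rpow_lt_rpow_of_neg (by positivity)
      (pow_lt_pow_left₀ hab ha.le two_ne_zero) (by linarith)
  have hRxy := hdec _ _ γ hx0 hlt (by linarith)
  have hone : ∀ a : ℝ, 0 < a → (a ^ 2) ^ (-γ) * a = (a ^ 2) ^ (-(γ - 1 / 2)) := fun a ha => by
    rw [← Real.rpow_natCast a 2, ← Real.rpow_mul ha.le, ← Real.rpow_mul ha.le]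
    nth_rewrite 2 [← Real.rpow_one a]
    rw [← Real.rpow_add ha]
    congr 1
    push_cast
    ring
  have hRxy' := hdec _ _ (γ - 1 / 2) hx0 hlt (by linarith)
  rw [← hone _ hx0, ← hone _ hy0] at hRxy'
  have hRpos : 0 < (‖x - y‖ ^ 2) ^ (-γ) := Real.rpow_pos_of_pos (by
    have : x - y ≠ 0 := fun h => by rw [sub_eq_zero.1 h] at hlt; exact lt_irrefl _ hlt
    have := norm_pos_iff.2 this
    positivity) _
  set f := (‖x‖ ^ 2) ^ (-γ) - lam with hf
  set g := (‖y‖ ^ 2) ^ (-γ) - lam with hg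
  have hgf : g < f := by rw [hf, hg]; linarith
  have hX : f * inner ℝ p x + g * inner ℝ p y = 0 := by
    have := congrArg (fun z => inner ℝ p z) h₁
    simpa only [inner_add_right, inner_smul_right, inner_zero_right] using this
  have hf0 : f ≠ 0 := by
    intro h0
    rw [h0, zero_smul, zero_add] at h₁
    have := (smul_eq_zero.1 h₁).resolve_right hy
    linarith
  have hg0 : g ≠ 0 := by
    intro h0
    rw [h0, zero_smul, add_zero] at h₁
    exact hf0 ((smul_eq_zero.1 h₁).resolve_right hx)
  have hfg : 0 < f / g := by
    have hpy : inner ℝ p y ≠ 0 := fun h => by rw [h, mul_zero] at hp; exact lt_irrefl _ hp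
    have hpx : inner ℝ p x ≠ 0 := fun h => by rw [h, zero_mul] at hp; exact lt_irrefl _ hp
    have h3 : f / g = -(inner ℝ p x * inner ℝ p y) / inner ℝ p x ^ 2 := by
      field_simp
      linarith
    rw [h3]
    exact div_pos (by linarith) (by positivity)
  have hyx : y = (-(f / g)) • x := by
    have h3 : g • y = (-f) • x := by rw [neg_smul]; exact eq_neg_of_add_eq_zero_right h₁
    rw [show -(f / g) = g⁻¹ * -f by field_simp, ← smul_smul, ← h3, smul_smul, inv_mul_cancel₀ hg0,
      one_smul]
  have hxy : x - y = (1 + f / g) • x := by rw [hyx]; module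
  have hnxy : ‖x‖ < ‖x - y‖ := by
    rw [hxy, norm_smul, Real.norm_eq_abs, abs_of_pos (by linarith)]
    nlinarith
  have hRx := hdec _ _ γ hx0 hnxy (by linarith)
  set h := (‖x - y‖ ^ 2) ^ (-γ) - lam with hh
  have hhf : h < f := by rw [hh, hf]; linarith
  have h3 : m * h * (1 + f / g) + m₃ * f = 0 := by
    rw [hxy, smul_smul, ← add_smul] at h₂
    exact (smul_eq_zero.1 h₂).resolve_right hx
  have hfpos : 0 < f := by
    rcases lt_or_gt_of_ne hf0 with hneg | hpos
    · have h4 : h < 0 := hhf.trans hneg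
      have : m * h * (1 + f / g) < 0 :=
        mul_neg_of_neg_of_pos (mul_neg_of_pos_of_neg hm h4) (by linarith)
      have : m₃ * f < 0 := mul_neg_of_pos_of_neg hm₃ hneg
      linarith
    · exact hpos
  have hhneg : h < 0 := by
    by_contra! h0
    have : 0 ≤ m * h * (1 + f / g) := by positivity
    have : 0 < m₃ * f := by positivity
    linarith
  have hlam : 0 < lam := by rw [hh] at hhneg; linarith
  have hnorm : ‖y‖ = f / g * ‖x‖ := by
    nth_rewrite 1 [hyx]
    rw [norm_smul, Real.norm_eq_abs, abs_neg, abs_of_pos hfg]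
  have h5 : g * ‖y‖ = f * ‖x‖ := by rw [hnorm]; field_simp
  have h6 : lam * ‖x‖ < lam * ‖y‖ := mul_lt_mul_of_pos_left hlt hlam
  rw [hf, hg, sub_mul, sub_mul] at h5
  linarith

variable {k : Finset (Fin 3)}

lemma sum_three {A : Type*} [AddCommMonoid A] (h₁ : 0 ∈ k) (h₂ : 1 ∈ k) (h₃ : 2 ∈ k) (F : k → A) :
    ∑ i, F i = F ⟨0, h₁⟩ + F ⟨1, h₂⟩ + F ⟨2, h₃⟩ := by
  obtain rfl : k = Finset.univ := by
    ext i
    fin_cases i <;> simp [h₁, h₂, h₃]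
  have hu : (Finset.univ : Finset (Finset.univ : Finset (Fin 3))) =
      {⟨0, h₁⟩, ⟨1, h₂⟩, ⟨2, h₃⟩} := by
    ext ⟨i, hi⟩
    fin_cases i <;> simp
  rw [hu, Finset.sum_insert (by simp), Finset.sum_insert (by simp), Finset.sum_singleton,
    add_assoc]

lemma sum_three_pairs (h₁ : 0 ∈ k) (h₂ : 1 ∈ k) (h₃ : 2 ∈ k) (F : k → k → ℝ) :
    ∑ i, ∑ j with i < j, F i j =
      F ⟨0, h₁⟩ ⟨1, h₂⟩ + F ⟨0, h₁⟩ ⟨2, h₃⟩ + F ⟨1, h₂⟩ ⟨2, h₃⟩ := by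
  simp only [Finset.sum_filter, sum_three h₁ h₂ h₃, Subtype.mk_lt_mk]
  simp

/-- In a central configuration of three bodies with `m₁ = m₂` whose third body lies strictly
between the other two in some direction, the third body has the same distance to the other two. -/
lemma IsCentralConfiguration.norm_sub_eq {α : ℝ} (hα : 0 < α) {m : Fin 3 → ℝ}
    (hm : ∀ i, 0 < m i) (hm₁₂ : m 0 = m 1) (h₁ : 0 ∈ k) (h₂ : 1 ∈ k) (h₃ : 2 ∈ k)
    {ξ : k → Plane} (h : IsCentralConfiguration α (fun i : k => m i) ξ) {p : Plane}
    (hp : inner ℝ p (ξ ⟨0, h₁⟩ - ξ ⟨2, h₃⟩) * inner ℝ p (ξ ⟨1, h₂⟩ - ξ ⟨2, h₃⟩) < 0) :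
    ‖ξ ⟨0, h₁⟩ - ξ ⟨2, h₃⟩‖ = ‖ξ ⟨1, h₂⟩ - ξ ⟨2, h₃⟩‖ := by
  have hM : ∑ i : k, m i ≠ 0 :=
    (Finset.sum_pos (s := (Finset.univ : Finset k)) (f := fun i : k => m i) (fun i _ => hm i)
      ⟨⟨0, h₁⟩, Finset.mem_univ _⟩).ne'
  have hI : ∑ i : k, m i * inner ℝ (ξ i) (ξ i) ≠ 0 := by
    intro h0
    have hz : ∀ i, ξ i = 0 := fun i => by
      have := (Finset.sum_eq_zero_iff_of_nonneg (s := (Finset.univ : Finset k))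
        (f := fun i : k => m i * inner ℝ (ξ i) (ξ i)) (fun i _ => mul_nonneg (hm i).le real_inner_self_nonneg)).1 h0 i (Finset.mem_univ i)
      exact inner_self_eq_zero.1 ((mul_eq_zero.1 this).resolve_left (hm i).ne')
    simp [hz] at hp
  obtain ⟨μ, hμ⟩ := h.exists_multiplier hα hM hI
  have hcm := h.2.1
  simp only [sum_three_pairs h₁ h₂ h₃, sum_three h₁ h₂ h₃] at hμ hcm hM
  set a := ξ ⟨0, h₁⟩ with ha
  set b := ξ ⟨1, h₂⟩ with hb
  set c := ξ ⟨2, h₃⟩ with hc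
  rw [← hm₁₂] at hμ hcm hM
  set Mt := m 0 + m 0 + m 2 with hMt
  set lam := μ / Mt with hlam
  have hμlam : μ = lam * Mt := by rw [hlam, div_mul_cancel₀ _ hM]
  have hm0 := hm 0
  have hm2 := hm 2
  set Rx := (‖a - c‖ ^ 2) ^ (-(α / 2 + 1)) with hRx
  set Ry := (‖b - c‖ ^ 2) ^ (-(α / 2 + 1)) with hRy
  set Rz := (‖a - b‖ ^ 2) ^ (-(α / 2 + 1)) with hRz
  have d01 : (⟨0, h₁⟩ : k) ≠ ⟨1, h₂⟩ := by simp
  have d02 : (⟨0, h₁⟩ : k) ≠ ⟨2, h₃⟩ := by simp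
  have d12 : (⟨1, h₂⟩ : k) ≠ ⟨2, h₃⟩ := by simp
  -- The equation of the third body.
  have e₁ : (Rx - lam) • (a - c) + (Ry - lam) • (b - c) = 0 := by
    refine ext_inner_right ℝ fun z => ?_
    have hw := hμ (Pi.single ⟨2, h₃⟩ z)
    have hcz := congrArg (fun y => inner ℝ y z) hcm
    simp only [Pi.single_eq_same, Pi.single_eq_of_ne d02, Pi.single_eq_of_ne d12, zero_sub,
      sub_zero, inner_neg_right, inner_zero_right, mul_zero, zero_add, hμlam, inner_sub_left] at hw
    simp only [inner_add_left, inner_smul_left, conj_trivial, inner_zero_left] at hcz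
    simp only [inner_add_left, inner_smul_left, conj_trivial, inner_zero_left, inner_sub_left]
    have hmm : m 0 * m 2 ≠ 0 := by positivity
    refine (mul_eq_zero.1 (?_ : m 0 * m 2 * _ = 0)).resolve_left hmm
    linear_combination -hw - lam * m 2 * hcz
  -- The equation of the first body.
  have e₂ : (m 0 * (Rz - lam)) • (a - b) + (m 2 * (Rx - lam)) • (a - c) = 0 := by
    refine ext_inner_right ℝ fun z => ?_
    have hw := hμ (Pi.single ⟨0, h₁⟩ z)
    have hcz := congrArg (fun y => inner ℝ y z) hcm
    simp only [Pi.single_eq_same, Pi.single_eq_of_ne d02.symm, Pi.single_eq_of_ne d01.symm,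
      sub_zero, inner_zero_right, mul_zero, add_zero, hμlam, inner_sub_left] at hw
    simp only [inner_add_left, inner_smul_left, conj_trivial, inner_zero_left] at hcz
    simp only [inner_add_left, inner_smul_left, conj_trivial, inner_zero_left, inner_sub_left]
    refine (mul_eq_zero.1 (?_ : m 0 * _ = 0)).resolve_left hm0.ne'
    linear_combination hw + lam * m 0 * hcz
  have hab : a - b = a - c - (b - c) := by abel
  have hγ : 1 / 2 < α / 2 + 1 := by linarith
  refine le_antisymm (not_lt.1 ?_) (not_lt.1 ?_)
  · have hba : b - c - (a - c) = -(a - b) := by abel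
    refine not_norm_lt_of_balanced (lam := lam) (p := p) hγ hm0 hm2 ?_ ?_ (by rwa [mul_comm])
    · rw [add_comm]
      exact e₁
    · rw [hba, norm_neg, smul_neg, ← hRz, ← hRy]
      have h4 : (m 2 * (Ry - lam)) • (b - c) = -((m 2 * (Rx - lam)) • (a - c)) := by
        rw [mul_smul, mul_smul, ← smul_neg]
        congr 1
        exact eq_neg_of_add_eq_zero_right e₁
      rw [h4, ← neg_add, e₂, neg_zero]
  · refine not_norm_lt_of_balanced (lam := lam) (p := p) hγ hm0 hm2 e₁ ?_ hp
    rw [← hab]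
    exact e₂

end ThreeBodies

/-! ### Directions of descent -/

section DescentDirections

/-- Pairwise bounds add up to a direction of descent. -/
lemma DescentDirection.of_pairBound {ι : Type*} [Fintype ι] [LinearOrder ι] {α : ℝ} {m : ι → ℝ}
    (hm : ∀ i, 0 < m i) {ξ e : ι → Plane} (c κ : ι → ι → ℝ) (hκ : ∀ i j, 0 ≤ κ i j)
    (h : ∀ i j, i < j → PairBound α (ξ i - ξ j) (e i - e j) (c i j) (κ i j))
    (hlt : (∑ i, ∑ j with i < j, m i * m j * κ i j) * ((2 + α) / α) <
      ∑ i, ∑ j with i < j, m i * m j * c i j) : DescentDirection α m ξ e := by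
  have hrw : ∀ u s : ℝ, potential α m (u • ξ + s • e) - potential α m (u • ξ) =
      ∑ i, ∑ j with i < j, m i * m j * (1 / ‖u • (ξ i - ξ j) + s • (e i - e j)‖ ^ α -
        1 / ‖u • (ξ i - ξ j)‖ ^ α) := by
    intro u s
    simp only [potential, ← Finset.sum_sub_distrib, Pi.add_apply, Pi.smul_apply]
    refine Finset.sum_congr rfl fun i _ => Finset.sum_congr rfl fun j _ => ?_
    rw [← smul_sub, show u • ξ i + s • e i - (u • ξ j + s • e j) =
      u • (ξ i - ξ j) + s • (e i - e j) by module]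
    ring
  refine ⟨fun i j hij u s hu hs hus => ?_, _, _, ?_, hlt, fun u s hu hs => ⟨fun hus => ?_,
    fun hsu => ?_⟩⟩
  · rcases lt_or_gt_of_ne hij with hlt | hlt
    · exact (h i j hlt).ne_zero u s hu hs hus
    · have h0 := (h j i hlt).ne_zero u s hu hs hus
      rw [show u • (ξ i - ξ j) + s • (e i - e j) = -(u • (ξ j - ξ i) + s • (e j - e i)) by module]
      exact neg_ne_zero.2 h0
  · exact Finset.sum_nonneg fun i _ => Finset.sum_nonneg fun j _ =>
      mul_nonneg (mul_pos (hm i) (hm j)).le (hκ i j)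
  · rw [hrw, ← Finset.sum_neg_distrib, Finset.sum_mul]
    refine Finset.sum_le_sum fun i _ => ?_
    rw [← Finset.sum_neg_distrib, Finset.sum_mul]
    refine Finset.sum_le_sum fun j hj => ?_
    have := mul_le_mul_of_nonneg_left ((h i j (Finset.mem_filter.1 hj).2).near u s hu hs hus)
      (mul_pos (hm i) (hm j)).le
    linarith
  · rw [hrw, Finset.sum_mul]
    refine Finset.sum_le_sum fun i _ => ?_
    rw [Finset.sum_mul]
    refine Finset.sum_le_sum fun j hj => ?_
    have := mul_le_mul_of_nonneg_left ((h i j (Finset.mem_filter.1 hj).2).far u s hu hs hsu)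
      (mul_pos (hm i) (hm j)).le
    linarith

/-- If no relative displacement points backwards, then `e` is a direction of descent. -/
lemma DescentDirection.of_inner_nonneg {ι : Type*} [Fintype ι] [LinearOrder ι] {α : ℝ}
    (hα : 0 < α) {m : ι → ℝ} (hm : ∀ i, 0 < m i) {ξ e : ι → Plane} {i₀ j₀ : ι} (h₀ : i₀ < j₀)
    (hξ : ∀ i j, i < j → ξ i - ξ j ≠ 0) (he : ∀ i j, i < j → e i - e j ≠ 0)
    (h : ∀ i j, i < j → 0 ≤ inner ℝ (ξ i - ξ j) (e i - e j)) : DescentDirection α m ξ e := by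
  have h1 : ∀ i j, ∃ c, 0 < c ∧ (i < j → PairBound α (ξ i - ξ j) (e i - e j) c 0) := by
    intro i j
    by_cases hij : i < j
    · obtain ⟨c, hc, H⟩ := exists_pairBound_of_inner_nonneg hα (hξ i j hij) (he i j hij) (h i j hij)
      exact ⟨c, hc, fun _ => H⟩
    · exact ⟨1, one_pos, fun h => absurd h hij⟩
  choose c hc H using h1
  refine .of_pairBound hm c (fun _ _ => 0) (fun _ _ => le_rfl) H ?_
  simp only [mul_zero, Finset.sum_const_zero, zero_mul]
  have hpos : ∀ i j, 0 < m i * m j * c i j := fun i j => mul_pos (mul_pos (hm i) (hm j)) (hc i j)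
  refine Finset.sum_pos' (fun i _ => Finset.sum_nonneg fun j _ => (hpos i j).le)
    ⟨i₀, Finset.mem_univ _, ?_⟩
  exact Finset.sum_pos (fun j _ => hpos i₀ j) ⟨j₀, Finset.mem_filter.2 ⟨Finset.mem_univ _, h₀⟩⟩

/-- The displacements that are symmetric with respect to the line spanned by `p`: the first two
bodies move to `d p ± b n`, the third one stays. -/
noncomputable def symmetricDisplacement (k : Finset (Fin 3)) (p n : Plane) (d b : ℝ) : k → Plane :=
  fun i => (![d • p + b • n, d • p - b • n, 0] : Fin 3 → Plane) i

variable {k : Finset (Fin 3)} {p n : Plane}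

lemma symmetricDisplacement_sub₀₁ (h₁ : 0 ∈ k) (h₂ : 1 ∈ k) (d b : ℝ) :
    symmetricDisplacement k p n d b ⟨0, h₁⟩ - symmetricDisplacement k p n d b ⟨1, h₂⟩ =
      (2 * b) • n := by
  simp only [symmetricDisplacement, Matrix.cons_val]
  module

lemma symmetricDisplacement_sub₀₂ (h₁ : 0 ∈ k) (h₃ : 2 ∈ k) (d b : ℝ) :
    symmetricDisplacement k p n d b ⟨0, h₁⟩ - symmetricDisplacement k p n d b ⟨2, h₃⟩ =
      d • p + b • n := by
  simp [symmetricDisplacement]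

lemma symmetricDisplacement_sub₁₂ (h₂ : 1 ∈ k) (h₃ : 2 ∈ k) (d b : ℝ) :
    symmetricDisplacement k p n d b ⟨1, h₂⟩ - symmetricDisplacement k p n d b ⟨2, h₃⟩ =
      d • p - b • n := by
  simp [symmetricDisplacement]

lemma pair_cases {i j : k} (hij : i < j) (h₁ : 0 ∈ k) (h₂ : 1 ∈ k) :
    (i = ⟨0, h₁⟩ ∧ j = ⟨1, h₂⟩) ∨
      ∃ h₃ : 2 ∈ k, (i = ⟨0, h₁⟩ ∧ j = ⟨2, h₃⟩) ∨ (i = ⟨1, h₂⟩ ∧ j = ⟨2, h₃⟩) := by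
  obtain ⟨i, hi⟩ := i
  obtain ⟨j, hj⟩ := j
  fin_cases i <;> fin_cases j <;> simp_all <;> exact hj

lemma norm_sq_smul_add_smul (hp : ‖p‖ = 1) (hn : ‖n‖ = 1) (hpn : inner ℝ p n = 0) (d b : ℝ) :
    ‖d • p + b • n‖ ^ 2 = d ^ 2 + b ^ 2 := by
  rw [norm_smul_add_smul_sq, hp, hn, hpn]
  ring

lemma smul_add_smul_ne_zero (hp : ‖p‖ = 1) (hn : ‖n‖ = 1) (hpn : inner ℝ p n = 0) (d : ℝ) {b : ℝ}
    (hb : b ≠ 0) : d • p + b • n ≠ 0 := by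
  intro h
  have := norm_sq_smul_add_smul hp hn hpn d b
  rw [h, norm_zero] at this
  have : 0 < b ^ 2 := by positivity
  nlinarith [sq_nonneg d]

lemma symmetricDisplacement_sub_ne_zero (hp : ‖p‖ = 1) (hn : ‖n‖ = 1) (hpn : inner ℝ p n = 0)
    (h₁ : 0 ∈ k) (h₂ : 1 ∈ k) (d : ℝ) {b : ℝ} (hb : b ≠ 0) (i j : k) (hij : i < j) :
    symmetricDisplacement k p n d b i - symmetricDisplacement k p n d b j ≠ 0 := by
  rcases pair_cases hij h₁ h₂ with ⟨rfl, rfl⟩ | ⟨h₃, ⟨rfl, rfl⟩ | ⟨rfl, rfl⟩⟩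
  · rw [symmetricDisplacement_sub₀₁]
    have := smul_add_smul_ne_zero hp hn hpn 0 (mul_ne_zero two_ne_zero hb)
    rwa [zero_smul, zero_add] at this
  · rw [symmetricDisplacement_sub₀₂]
    exact smul_add_smul_ne_zero hp hn hpn d hb
  · rw [symmetricDisplacement_sub₁₂, sub_eq_add_neg, ← neg_smul]
    exact smul_add_smul_ne_zero hp hn hpn d (neg_ne_zero.2 hb)

/-- If the first two bodies lie weakly on the same side of the third in the direction `p`, then
moving both of them away from it along `p`, and only slightly apart in the direction `n`, is a
direction of descent. For bodies on a line orthogonal to `p` with the third one at an end,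
obtuse angles are unavoidable here. -/
lemma eventually_descentDirection {α : ℝ} (hα : 0 < α) {m : Fin 3 → ℝ} (hm : ∀ i, 0 < m i)
    (hp : ‖p‖ = 1) (hn : ‖n‖ = 1) (hpn : inner ℝ p n = 0) (h₁ : 0 ∈ k) (h₂ : 1 ∈ k) (h₃ : 2 ∈ k)
    {ξ : k → Plane} (hξ : ∀ i j, i < j → ξ i - ξ j ≠ 0) {d τ : ℝ} (hd : d ^ 2 = 1) (hτ : τ ^ 2 = 1)
    (hτn : 0 ≤ τ * inner ℝ n (ξ ⟨0, h₁⟩ - ξ ⟨1, h₂⟩))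
    (hd₀ : 0 ≤ d * inner ℝ p (ξ ⟨0, h₁⟩ - ξ ⟨2, h₃⟩))
    (hd₁ : 0 ≤ d * inner ℝ p (ξ ⟨1, h₂⟩ - ξ ⟨2, h₃⟩)) :
    ∀ᶠ η in nhdsWithin (0 : ℝ) (Set.Ioi 0),
      DescentDirection α (fun i : k => m i) ξ (symmetricDisplacement k p n d (τ * η)) := by
  have l01 : (⟨0, h₁⟩ : k) < ⟨1, h₂⟩ := by simp
  have l02 : (⟨0, h₁⟩ : k) < ⟨2, h₃⟩ := by simp
  have l12 : (⟨1, h₂⟩ : k) < ⟨2, h₃⟩ := by simp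
  obtain ⟨c₀, C₀, η₀, hc₀, hC₀, hη₀, H₀⟩ := exists_pairBound hα (hξ _ _ l02) one_pos
  obtain ⟨c₁, C₁, η₁, hc₁, hC₁, hη₁, H₁⟩ := exists_pairBound hα (hξ _ _ l12) one_pos
  set Y₀ := |inner ℝ n (ξ ⟨0, h₁⟩ - ξ ⟨2, h₃⟩)| with hY₀
  set Y₁ := |inner ℝ n (ξ ⟨1, h₂⟩ - ξ ⟨2, h₃⟩)| with hY₁
  have hsmall : ∀ A B : ℝ, 0 < B →
      ∀ᶠ η in nhdsWithin (0 : ℝ) (Set.Ioi 0), η * A < B := fun A B hB => by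
    have h1 : Continuous fun η : ℝ => η * A := by fun_prop
    have h2 := (h1.tendsto 0).eventually_lt_const (by rwa [zero_mul] : 0 * A < B)
    exact nhdsWithin_le_nhds h2
  have hτ' : |τ| = 1 := by
    rw [← sq_abs] at hτ
    exact (pow_eq_one_iff_of_nonneg (abs_nonneg τ) two_ne_zero).1 hτ
  have hcpos : 0 < m 0 * m 2 * c₀ + m 1 * m 2 * c₁ := by
    have := hm 0
    have := hm 1
    have := hm 2
    positivity
  filter_upwards [self_mem_nhdsWithin, hsmall Y₀ η₀ hη₀, hsmall Y₁ η₁ hη₁,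
    hsmall ((m 0 * m 2 * (C₀ * Y₀) + m 1 * m 2 * (C₁ * Y₁)) * ((2 + α) / α)) _ hcpos]
    with η hη hs₀ hs₁ hs
  have hη0 : 0 < η := hη
  have hτη : τ * η ≠ 0 := by
    refine mul_ne_zero (fun h => ?_) hη0.ne'
    rw [h] at hτ
    norm_num at hτ
  have habs : ∀ z : ℝ, |τ * η * z| = η * |z| := fun z => by
    rw [abs_mul, abs_mul, hτ', one_mul, abs_of_pos hη0]
  have b₀ : PairBound α (ξ ⟨0, h₁⟩ - ξ ⟨2, h₃⟩) (d • p + (τ * η) • n) c₀ (C₀ * (η * Y₀)) := by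
    refine H₀ _ _ ?_ (by positivity) hs₀.le ?_
    · rw [norm_sq_smul_add_smul hp hn hpn, hd]
      nlinarith [sq_nonneg (τ * η)]
    · rw [real_inner_comm, inner_add_left, real_inner_smul_left, real_inner_smul_left, hY₀,
        ← habs]
      linarith [neg_abs_le (τ * η * inner ℝ n (ξ ⟨0, h₁⟩ - ξ ⟨2, h₃⟩))]
  have b₁ : PairBound α (ξ ⟨1, h₂⟩ - ξ ⟨2, h₃⟩) (d • p - (τ * η) • n) c₁ (C₁ * (η * Y₁)) := by
    refine H₁ _ _ ?_ (by positivity) hs₁.le ?_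
    · rw [sub_eq_add_neg, ← neg_smul, norm_sq_smul_add_smul hp hn hpn, hd]
      nlinarith [sq_nonneg (-(τ * η))]
    · rw [real_inner_comm, inner_sub_left, real_inner_smul_left, real_inner_smul_left, hY₁,
        ← habs]
      linarith [le_abs_self (τ * η * inner ℝ n (ξ ⟨1, h₂⟩ - ξ ⟨2, h₃⟩))]
  have b₂ : PairBound α (ξ ⟨0, h₁⟩ - ξ ⟨1, h₂⟩) ((2 * (τ * η)) • n) 0 0 := by
    have hne := symmetricDisplacement_sub_ne_zero hp hn hpn h₁ h₂ d hτη _ _ l01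
    rw [symmetricDisplacement_sub₀₁] at hne
    obtain ⟨c, hc, H⟩ := exists_pairBound_of_inner_nonneg hα (hξ _ _ l01) hne (by
      rw [real_inner_comm, real_inner_smul_left]
      nlinarith)
    exact H.mono_left hc.le
  refine .of_pairBound (m := fun i : k => m i) (fun i => hm i)
    (fun i j => (![![0, 0, c₀], ![0, 0, c₁], ![0, 0, 0]] : Fin 3 → Fin 3 → ℝ) i j)
    (fun i j => (![![0, 0, C₀ * (η * Y₀)], ![0, 0, C₁ * (η * Y₁)], ![0, 0, 0]] :
      Fin 3 → Fin 3 → ℝ) i j) ?_ ?_ ?_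
  · have hk₀ : 0 ≤ C₀ * (η * Y₀) := by positivity
    have hk₁ : 0 ≤ C₁ * (η * Y₁) := by positivity
    rintro ⟨i, hi⟩ ⟨j, hj⟩
    fin_cases i <;> fin_cases j <;> simp [hk₀, hk₁]
  · intro i j hij
    rcases pair_cases hij h₁ h₂ with ⟨rfl, rfl⟩ | ⟨h₃, ⟨rfl, rfl⟩ | ⟨rfl, rfl⟩⟩
    · rw [symmetricDisplacement_sub₀₁]
      simpa using b₂
    · rw [symmetricDisplacement_sub₀₂]
      simpa using b₀
    · rw [symmetricDisplacement_sub₁₂]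
      simpa using b₁
  · rw [sum_three_pairs h₁ h₂ h₃, sum_three_pairs h₁ h₂ h₃]
    simp only [Matrix.cons_val]
    linarith

/-- Let `(P, Q)` and `(R, S)` be the positions of the first two bodies relative to the third, in
coordinates along the line and across it. If they have the same length and lie on different sides
along the line, then some symmetric displacement points backwards for none of the pairs. -/
lemma exists_symmetric_of_isosceles {P Q R S : ℝ} (hPR : P * R < 0)
    (h : P ^ 2 + Q ^ 2 = R ^ 2 + S ^ 2) :
    ∃ d b : ℝ, b ≠ 0 ∧ 0 ≤ b * (Q - S) ∧ 0 ≤ d * P + b * Q ∧ 0 ≤ d * R - b * S := by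
  have key : ∀ P Q R S : ℝ, P * R < 0 → P ^ 2 + Q ^ 2 = R ^ 2 + S ^ 2 → S ≤ Q →
      ∃ d : ℝ, 0 ≤ d * P + Q ∧ 0 ≤ d * R - S := by
    intro P Q R S hPR h hSQ
    have hP : P ≠ 0 := by rintro rfl; simp at hPR
    -- `d` makes the first relative displacement orthogonal to the first relative position.
    refine ⟨-Q / P, by rw [div_mul_cancel₀ _ hP]; linarith, ?_⟩
    have hPR' : |P * R| = -(P * R) := abs_of_neg hPR
    have hmain : S * |P| ≤ Q * |R| := by
      have hP0 := abs_nonneg P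
      have hR0 := abs_nonneg R
      rw [← sq_abs P, ← sq_abs R] at h
      rcases le_total 0 S with hS | hS
      · have : |P| ≤ |R| := by
          refine le_of_sq_le_sq ?_ hR0
          nlinarith
        exact mul_le_mul hSQ this hP0 (hS.trans hSQ)
      · rcases le_total 0 Q with hQ | hQ
        · exact (mul_nonpos_of_nonpos_of_nonneg hS hP0).trans (mul_nonneg hQ hR0)
        · have : |R| ≤ |P| := by
            refine le_of_sq_le_sq ?_ hP0
            nlinarith
          nlinarith
    have h1 : -Q / P * R - S = (Q * |R| - S * |P|) / |P| := by
      have hPP : |P| * |P| = P * P := abs_mul_abs_self P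
      have hP' : |P| ≠ 0 := abs_ne_zero.2 hP
      have h2 : |R| = -(P * R) / |P| := by
        rw [eq_div_iff hP', mul_comm, ← abs_mul, hPR']
      rw [h2]
      field_simp
      rw [sq_abs]
      ring
    rw [h1]
    exact div_nonneg (by linarith) (abs_nonneg P)
  rcases le_total S Q with hSQ | hSQ
  · obtain ⟨d, h1, h2⟩ := key P Q R S hPR h hSQ
    exact ⟨d, 1, one_ne_zero, by linarith, by linarith, by linarith⟩
  · obtain ⟨d, h1, h2⟩ := key P (-Q) R (-S) hPR (by linarith) (by linarith)
    exact ⟨d, -1, by norm_num, by linarith, by linarith, by linarith⟩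

end DescentDirections

/-! ### The symmetry -/

section Reflection

/-- Coordinates along a line of the plane and across it. -/
lemma exists_line_coordinates {l : Submodule ℝ Plane} (hl : Module.finrank ℝ l = 1) :
    ∃ p n : Plane, ‖p‖ = 1 ∧ ‖n‖ = 1 ∧ inner ℝ p n = 0 ∧ l.reflection p = p ∧
      l.reflection n = -n ∧ ∀ x : Plane, ‖x‖ ^ 2 = inner ℝ p x ^ 2 + inner ℝ n x ^ 2 := by
  obtain ⟨v, hv0, hv⟩ := finrank_eq_one_iff'.1 hl
  have hv0' : (v : Plane) ≠ 0 := fun h => hv0 (Subtype.ext h)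
  set p : Plane := ‖(v : Plane)‖⁻¹ • (v : Plane) with hpdef
  have hp : ‖p‖ = 1 := norm_smul_inv_norm (𝕜 := ℝ) hv0'
  have hpl : p ∈ l := l.smul_mem _ v.2
  set n : Plane := !₂[-p 1, p 0] with hndef
  have hn0 : n 0 = -p 1 := rfl
  have hn1 : n 1 = p 0 := rfl
  have hp2 : p 0 ^ 2 + p 1 ^ 2 = 1 := by
    have := EuclideanSpace.real_norm_sq_eq p
    rw [hp, Fin.sum_univ_two] at this
    linarith
  have hinner : ∀ x y : Plane, inner ℝ x y = x 0 * y 0 + x 1 * y 1 := fun x y => by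
    rw [PiLp.inner_apply, Fin.sum_univ_two]
    simp [mul_comm]
  have hnorm : ∀ x : Plane, ‖x‖ ^ 2 = inner ℝ p x ^ 2 + inner ℝ n x ^ 2 := fun x => by
    rw [EuclideanSpace.real_norm_sq_eq, Fin.sum_univ_two, hinner, hinner, hn0, hn1]
    linear_combination -(x 0 ^ 2 + x 1 ^ 2) * hp2
  have hpn : inner ℝ p n = 0 := by rw [hinner, hn0, hn1]; ring
  have hn : ‖n‖ = 1 := by
    have h1 : ‖n‖ ^ 2 = 1 := by
      rw [EuclideanSpace.real_norm_sq_eq, Fin.sum_univ_two, hn0, hn1]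
      linarith
    exact (pow_eq_one_iff_of_nonneg (norm_nonneg _) two_ne_zero).1 h1
  refine ⟨p, n, hp, hn, hpn, l.reflection_mem_subspace_eq_self hpl, ?_, hnorm⟩
  refine l.reflection_mem_subspace_orthogonalComplement_eq_neg ?_
  refine (Submodule.mem_orthogonal _ _).2 fun x hx => ?_
  obtain ⟨c, hc⟩ := hv ⟨x, hx⟩
  have hx' : x = (c * ‖(v : Plane)‖) • p := by
    rw [hpdef, smul_smul, mul_assoc, mul_inv_cancel₀ (norm_ne_zero_iff.2 hv0'), mul_one]
    exact (congrArg Subtype.val hc).symm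
  rw [hx', real_inner_smul_left, hpn, mul_zero]

variable {l : Submodule ℝ Plane}

lemma inner_reflection_right (x y : Plane) :
    inner ℝ x (l.reflection y) = inner ℝ (l.reflection x) y := by
  rw [← l.reflection.inner_map_map (l.reflection x) y, l.reflection_reflection]

variable {ι : Type*}

lemma act_add (σ : Equiv.Perm ι) (x y : ι → Plane) : act l σ (x + y) = act l σ x + act l σ y := by
  funext i
  simp [act]

lemma act_smul (σ : Equiv.Perm ι) (c : ℝ) (x : ι → Plane) : act l σ (c • x) = c • act l σ x := by
  funext i
  simp [act]

lemma act_symmetricDisplacement {k : Finset (Fin 3)} {p n : Plane} (hp : l.reflection p = p)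
    (hn : l.reflection n = -n) (h₁ : 0 ∈ k) (h₂ : 1 ∈ k) (d b : ℝ) :
    act l (Equiv.swap (⟨0, h₁⟩ : k) ⟨1, h₂⟩) (symmetricDisplacement k p n d b) =
      symmetricDisplacement k p n d b := by
  funext i
  obtain ⟨i, hi⟩ := i
  rw [act, Equiv.symm_swap]
  fin_cases i
  · simp [symmetricDisplacement, Equiv.swap_apply_left, hp, hn]
  · simp [symmetricDisplacement, Equiv.swap_apply_right, hp, hn, sub_eq_add_neg]
  · rw [Equiv.swap_apply_of_ne_of_ne (by simp) (by simp)]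
    simp [symmetricDisplacement]

lemma IsEquivariant.add {σ : Equiv.Perm ι} {x y : ℝ → ι → Plane} (hx : IsEquivariant l σ x)
    (hy : IsEquivariant l σ y) : IsEquivariant l σ (x + y) := fun t => by
  rw [Pi.add_apply, Pi.add_apply, act_add, hx t, hy t]

variable [Fintype ι]

lemma isEquivariant_standardVariation {σ : Equiv.Perm ι} {e : ι → Plane} (he : act l σ e = e)
    (hN : 0 < euclNorm e) {s : ℝ} (hs : 0 < s) (T : ℝ) :
    IsEquivariant l σ (standardVariation (s • e) T) := fun t => by
  rw [standardVariation_neg, standardVariation_smul hN hs, act_smul, he]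

lemma not_hasCollision_add_standardVariation [LinearOrder ι] {α : ℝ} {m : ι → ℝ}
    {ξp ξn e : ι → Plane}
    (hp : DescentDirection α m ξp e) (hn : DescentDirection α m ξn e) (hN : 0 < euclNorm e)
    {q : ℝ → ι → Plane}
    (hqp : ∀ t : ℝ, 0 ≤ t → ∀ i, q t i = |t| ^ (2 / (2 + α)) • ξp i)
    (hqn : ∀ t : ℝ, t ≤ 0 → ∀ i, q t i = |t| ^ (2 / (2 + α)) • ξn i) {s T : ℝ} (hs : 0 < s)
    (hT : 0 < T) (t : ℝ) : ¬ HasCollision ((q + standardVariation (s • e) T) t) := by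
  rintro ⟨i, j, hij, h⟩
  have hu : 0 ≤ |t| ^ (2 / (2 + α)) := Real.rpow_nonneg (abs_nonneg t) _
  have hus : 0 < |t| ^ (2 / (2 + α)) + profile (euclNorm e) T s |t| := by
    rcases lt_or_ge |t| T with hlt | hge
    · exact add_pos_of_nonneg_of_pos hu (profile_pos hN hs hlt)
    · exact add_pos_of_pos_of_nonneg (Real.rpow_pos_of_pos (hT.trans_le hge) _)
        (profile_nonneg _ _ _ _)
  rw [Pi.add_apply, Pi.add_apply, Pi.add_apply, standardVariation_smul hN hs] at h
  rcases le_total 0 t with ht | ht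
  · rw [hqp t ht, hqp t ht] at h
    exact hp.sub_ne_zero hu (profile_nonneg _ _ _ _) hus hij (sub_eq_zero.2 h)
  · rw [hqn t ht, hqn t ht] at h
    exact hn.sub_ne_zero hu (profile_nonneg _ _ _ _) hus hij (sub_eq_zero.2 h)

end Reflection

/-- Some symmetric displacement is a direction of descent for both branches of the trajectory. -/
lemma exists_descentDirection {α : ℝ} (hα : 0 < α) {m : Fin 3 → ℝ} (hm : ∀ i, 0 < m i)
    (hm₁₂ : m 0 = m 1) {k : Finset (Fin 3)} (h₁ : 0 ∈ k) (h₂ : 1 ∈ k) {l : Submodule ℝ Plane}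
    {p n : Plane} (hp : ‖p‖ = 1) (hn : ‖n‖ = 1) (hpn : inner ℝ p n = 0) (hlp : l.reflection p = p)
    (hln : l.reflection n = -n)
    (hnorm : ∀ x : Plane, ‖x‖ ^ 2 = inner ℝ p x ^ 2 + inner ℝ n x ^ 2) {ξp ξn : k → Plane}
    (hξp : IsCentralConfiguration α (fun i : k => m i) ξp)
    (hξn : IsCentralConfiguration α (fun i : k => m i) ξn)
    (hact : ξn = act l (Equiv.swap (⟨0, h₁⟩ : k) ⟨1, h₂⟩) ξp) :
    ∃ d b : ℝ, b ≠ 0 ∧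
      DescentDirection α (fun i : k => m i) ξp (symmetricDisplacement k p n d b) ∧
      DescentDirection α (fun i : k => m i) ξn (symmetricDisplacement k p n d b) := by
  have hne : ∀ {ξ : k → Plane}, IsCentralConfiguration α (fun i : k => m i) ξ →
      ∀ i j, i < j → ξ i - ξ j ≠ 0 :=
    fun h i j hij h0 => h.1 ⟨i, j, hij.ne, sub_eq_zero.1 h0⟩
  have l01 : (⟨0, h₁⟩ : k) < ⟨1, h₂⟩ := by simp
  have hip : ∀ i, inner ℝ p (ξn i) = inner ℝ p (ξp (Equiv.swap ⟨0, h₁⟩ ⟨1, h₂⟩ i)) := fun i => by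
    rw [hact, act, inner_reflection_right, hlp, Equiv.symm_swap]
  have hin : ∀ i, inner ℝ n (ξn i) = -inner ℝ n (ξp (Equiv.swap ⟨0, h₁⟩ ⟨1, h₂⟩ i)) := fun i => by
    rw [hact, act, inner_reflection_right, hln, Equiv.symm_swap, inner_neg_left]
  have s0 : Equiv.swap (⟨0, h₁⟩ : k) ⟨1, h₂⟩ ⟨0, h₁⟩ = ⟨1, h₂⟩ := Equiv.swap_apply_left _ _
  have s1 : Equiv.swap (⟨0, h₁⟩ : k) ⟨1, h₂⟩ ⟨1, h₂⟩ = ⟨0, h₁⟩ := Equiv.swap_apply_right _ _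
  have s2 : ∀ h₃ : 2 ∈ k, Equiv.swap (⟨0, h₁⟩ : k) ⟨1, h₂⟩ ⟨2, h₃⟩ = ⟨2, h₃⟩ := fun h₃ =>
    Equiv.swap_apply_of_ne_of_ne (by simp) (by simp)
  have hn01 : inner ℝ n (ξn ⟨0, h₁⟩ - ξn ⟨1, h₂⟩) = inner ℝ n (ξp ⟨0, h₁⟩ - ξp ⟨1, h₂⟩) := by
    rw [inner_sub_right, inner_sub_right, hin, hin, s0, s1]
    ring
  obtain ⟨τ, hτ, hτn⟩ : ∃ τ : ℝ, τ ^ 2 = 1 ∧ 0 ≤ τ * inner ℝ n (ξp ⟨0, h₁⟩ - ξp ⟨1, h₂⟩) := by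
    rcases le_total 0 (inner ℝ n (ξp ⟨0, h₁⟩ - ξp ⟨1, h₂⟩)) with h | h
    · exact ⟨1, by norm_num, by linarith⟩
    · exact ⟨-1, by norm_num, by linarith⟩
  by_cases h₃ : 2 ∈ k
  · have hp02 : inner ℝ p (ξn ⟨0, h₁⟩ - ξn ⟨2, h₃⟩) = inner ℝ p (ξp ⟨1, h₂⟩ - ξp ⟨2, h₃⟩) := by
      rw [inner_sub_right, inner_sub_right, hip, hip, s0, s2]
    have hp12 : inner ℝ p (ξn ⟨1, h₂⟩ - ξn ⟨2, h₃⟩) = inner ℝ p (ξp ⟨0, h₁⟩ - ξp ⟨2, h₃⟩) := by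
      rw [inner_sub_right, inner_sub_right, hip, hip, s1, s2]
    have hn02 : inner ℝ n (ξn ⟨0, h₁⟩ - ξn ⟨2, h₃⟩) = -inner ℝ n (ξp ⟨1, h₂⟩ - ξp ⟨2, h₃⟩) := by
      rw [inner_sub_right, inner_sub_right, hin, hin, s0, s2]
      ring
    have hn12 : inner ℝ n (ξn ⟨1, h₂⟩ - ξn ⟨2, h₃⟩) = -inner ℝ n (ξp ⟨0, h₁⟩ - ξp ⟨2, h₃⟩) := by
      rw [inner_sub_right, inner_sub_right, hin, hin, s1, s2]
      ring
    rcases lt_or_ge (inner ℝ p (ξp ⟨0, h₁⟩ - ξp ⟨2, h₃⟩) *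
      inner ℝ p (ξp ⟨1, h₂⟩ - ξp ⟨2, h₃⟩)) 0 with hlt | hge
    · have hiso := hξp.norm_sub_eq hα hm hm₁₂ h₁ h₂ h₃ hlt
      have hiso' := congrArg (· ^ 2) hiso
      simp only [hnorm] at hiso'
      obtain ⟨d, b, hb, e₁, e₂, e₃⟩ := exists_symmetric_of_isosceles hlt hiso'
      rw [← inner_sub_right, sub_sub_sub_cancel_right] at e₁
      have hdesc : ∀ {ξ : k → Plane}, IsCentralConfiguration α (fun i : k => m i) ξ →
          0 ≤ b * inner ℝ n (ξ ⟨0, h₁⟩ - ξ ⟨1, h₂⟩) →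
          0 ≤ d * inner ℝ p (ξ ⟨0, h₁⟩ - ξ ⟨2, h₃⟩) + b * inner ℝ n (ξ ⟨0, h₁⟩ - ξ ⟨2, h₃⟩) →
          0 ≤ d * inner ℝ p (ξ ⟨1, h₂⟩ - ξ ⟨2, h₃⟩) - b * inner ℝ n (ξ ⟨1, h₂⟩ - ξ ⟨2, h₃⟩) →
          DescentDirection α (fun i : k => m i) ξ (symmetricDisplacement k p n d b) := by
        intro ξ hξ f₁ f₂ f₃
        refine .of_inner_nonneg (m := fun i : k => m i) hα (fun i => hm i) l01 (hne hξ)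
          (symmetricDisplacement_sub_ne_zero hp hn hpn h₁ h₂ d hb) fun i j hij => ?_
        rcases pair_cases hij h₁ h₂ with ⟨rfl, rfl⟩ | ⟨h₃, ⟨rfl, rfl⟩ | ⟨rfl, rfl⟩⟩
        · rw [symmetricDisplacement_sub₀₁, real_inner_comm, real_inner_smul_left]
          linarith
        · rw [symmetricDisplacement_sub₀₂, real_inner_comm, inner_add_left, real_inner_smul_left,
            real_inner_smul_left]
          exact f₂
        · rw [symmetricDisplacement_sub₁₂, real_inner_comm, inner_sub_left, real_inner_smul_left,
            real_inner_smul_left]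
          exact f₃
      refine ⟨d, b, hb, hdesc hξp e₁ e₂ e₃, hdesc hξn ?_ ?_ ?_⟩
      · rwa [hn01]
      · rw [hp02, hn02]
        linarith
      · rw [hp12, hn12]
        linarith
    · obtain ⟨d, hd, hd₀, hd₁⟩ : ∃ d : ℝ, d ^ 2 = 1 ∧
          0 ≤ d * inner ℝ p (ξp ⟨0, h₁⟩ - ξp ⟨2, h₃⟩) ∧
          0 ≤ d * inner ℝ p (ξp ⟨1, h₂⟩ - ξp ⟨2, h₃⟩) := by
        rcases mul_nonneg_iff.1 hge with ⟨f₀, f₁⟩ | ⟨f₀, f₁⟩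
        · exact ⟨1, by norm_num, by linarith, by linarith⟩
        · exact ⟨-1, by norm_num, by linarith, by linarith⟩
      have H := (eventually_descentDirection hα hm hp hn hpn h₁ h₂ h₃ (hne hξp) hd hτ hτn hd₀
        hd₁).and (eventually_descentDirection hα hm hp hn hpn h₁ h₂ h₃ (hne hξn) hd hτ
        (by rwa [hn01]) (by rwa [hp02]) (by rwa [hp12]))
      obtain ⟨η, ⟨H₁, H₂⟩, hη⟩ := (H.and self_mem_nhdsWithin).exists
      have hη0 : 0 < η := hη
      refine ⟨d, τ * η, mul_ne_zero (fun h => ?_) hη0.ne', H₁, H₂⟩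
      rw [h] at hτ
      norm_num at hτ
  · have hτ0 : τ ≠ 0 := fun h => by
      rw [h] at hτ
      norm_num at hτ
    have hdesc : ∀ {ξ : k → Plane}, IsCentralConfiguration α (fun i : k => m i) ξ →
        0 ≤ τ * inner ℝ n (ξ ⟨0, h₁⟩ - ξ ⟨1, h₂⟩) →
        DescentDirection α (fun i : k => m i) ξ (symmetricDisplacement k p n 0 τ) := by
      intro ξ hξ f₁
      refine .of_inner_nonneg (m := fun i : k => m i) hα (fun i => hm i) l01 (hne hξ)
        (symmetricDisplacement_sub_ne_zero hp hn hpn h₁ h₂ 0 hτ0) fun i j hij => ?_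
      rcases pair_cases hij h₁ h₂ with ⟨rfl, rfl⟩ | ⟨h, -⟩
      · rw [symmetricDisplacement_sub₀₁, real_inner_comm, real_inner_smul_left]
        linarith
      · exact absurd h h₃
    exact ⟨0, τ, hτ0, hdesc hξp hτn, hdesc hξn (by rwa [hn01])⟩

end NBody

theorem mainTheorem3 (α : ℝ) (hα₀ : 0 < α) (hα₂ : α < 2)
    (m : Fin 3 → ℝ) (hm : ∀ i, 0 < m i) (hm₁₂ : m 0 = m 1)
    (k : Finset (Fin 3)) (h₁ : 0 ∈ k) (h₂ : 1 ∈ k)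
    (l : Submodule ℝ Plane) (hl : Module.finrank ℝ l = 1)
    (q : ℝ → k → Plane)
    (hq : NBody.IsParabolicCollisionTrajectory α (fun i : k => m i) q)
    (hq_eq : NBody.IsEquivariant l (Equiv.swap (⟨0, h₁⟩ : k) ⟨1, h₂⟩) q) :
    (∀ T : ℝ, 0 < T → ∀ ε : ℝ, 0 < ε → ∃ δ : k → Plane,
      0 < NBody.euclNorm δ ∧ NBody.euclNorm δ < ε ∧ NBody.euclNorm δ < T ∧
      NBody.IsEquivariant l (Equiv.swap (⟨0, h₁⟩ : k) ⟨1, h₂⟩) (NBody.standardVariation δ T) ∧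
      ¬ NBody.HasCollision ((q + NBody.standardVariation δ T) 0) ∧
      NBody.FiniteActionVariation α (fun i : k => m i) q (NBody.standardVariation δ T) ∧
      NBody.actionVariation α (fun i : k => m i) q (NBody.standardVariation δ T) < 0) ∧
    ¬ NBody.IsEquivariantMinimizing α (fun i : k => m i) l
        (Equiv.swap (⟨0, h₁⟩ : k) ⟨1, h₂⟩) q := by
  obtain ⟨ξp, ξn, hξp, hξn, hqp, hqn⟩ := hq
  obtain ⟨p, n, hp, hn, hpn, hlp, hln, hnorm⟩ := NBody.exists_line_coordinates hl
  -- At time `1`, equivariance of the trajectory says that `g₀` exchanges the two branches.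
  have hact : ξn = NBody.act l (Equiv.swap (⟨0, h₁⟩ : k) ⟨1, h₂⟩) ξp := by
    have hp1 : q 1 = ξp := funext fun i => by simp [hqp 1 zero_le_one i]
    have hn1 : q (-1) = ξn := funext fun i => by simp [hqn (-1) (by norm_num) i]
    rw [← hp1, ← hn1]
    exact hq_eq 1
  obtain ⟨d, b, hb, Hp, Hn⟩ := NBody.exists_descentDirection hα₀ hm hm₁₂ h₁ h₂ hp hn hpn hlp hln
    hnorm hξp hξn hact
  set e := NBody.symmetricDisplacement k p n d b with he
  have hN : 0 < NBody.euclNorm e := by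
    refine NBody.euclNorm_pos (i := ⟨0, h₁⟩) ?_
    simpa [he, NBody.symmetricDisplacement] using NBody.smul_add_smul_ne_zero hp hn hpn d hb
  have hinv := NBody.act_symmetricDisplacement hlp hln h₁ h₂ d b
  rw [← he] at hinv
  have main : ∀ T : ℝ, 0 < T → ∀ ε : ℝ, 0 < ε → ∃ δ : k → Plane,
      0 < NBody.euclNorm δ ∧ NBody.euclNorm δ < ε ∧ NBody.euclNorm δ < T ∧
      NBody.IsEquivariant l (Equiv.swap (⟨0, h₁⟩ : k) ⟨1, h₂⟩) (NBody.standardVariation δ T) ∧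
      ¬ NBody.HasCollision ((q + NBody.standardVariation δ T) 0) ∧
      NBody.FiniteActionVariation α (fun i : k => m i) q (NBody.standardVariation δ T) ∧
      NBody.actionVariation α (fun i : k => m i) q (NBody.standardVariation δ T) < 0 := by
    intro T hT ε hε
    have hsmall : ∀ c : ℝ, 0 < c → ∀ᶠ s in nhdsWithin (0 : ℝ) (Set.Ioi 0), s < c := fun c hc =>
      nhdsWithin_le_nhds (Iio_mem_nhds hc)
    obtain ⟨s, ⟨⟨hint, hneg⟩, hsε, hsT⟩, hs⟩ :=
      (((NBody.eventually_actionVariation_neg hα₀ hα₂ Hp Hn hN hqp hqn hT).and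
        ((hsmall (ε / NBody.euclNorm e) (by positivity)).and
        (hsmall (T / NBody.euclNorm e) (by positivity)))).and self_mem_nhdsWithin).exists
    have hs0 : 0 < s := hs
    have hcol := NBody.not_hasCollision_add_standardVariation Hp Hn hN hqp hqn hs0 hT
    rw [lt_div_iff₀ hN] at hsε hsT
    refine ⟨s • e, ?_, ?_, ?_, NBody.isEquivariant_standardVariation hinv hN hs0 T, hcol 0,
      ⟨Filter.Eventually.of_forall hcol, hint⟩, hneg⟩
    all_goals rw [NBody.euclNorm_smul hs0.le]
    · positivity
    · exact hsε
    · exact hsT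
  refine ⟨main, fun hmin => ?_⟩
  obtain ⟨δ, hδ, -, hδT, heq, -, hfin, hneg⟩ := main 1 one_pos 1 one_pos
  have hH1 := NBody.memH1_standardVariation (T := 1) hδ one_pos (by rwa [one_mul])
  rw [one_smul] at hH1
  exact absurd (hmin _ hH1 (hq_eq.add heq) hfin) (not_le.2 hneg)
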